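/- Let $K\subseteq\mathbb{R}^n$ ($n\ge 1$) be the closure of a bounded open set, endowed with Lebesgue measure $dx$, and let $d$ be a metric on $K$ that is continuous on $K\times K$. Let $x_1,\dots,x_N\in K$ ($N\ge 1$) be distinct points such that for all $i\neq j$ and all $t\in\mathbb{R}$ the set $\{x\in K: d(x,x_i)-d(x,x_j)=t\}$ has measure zero, let $\mu=\frac1N\sum_{i=1}^N\delta_{x_i}$, let $p$ be a continuous, strictly positive probability density on $K$, and let $\delta>0$. Let $B_\delta(\mu)$ be the set of probability distributions $\nu$ on $K$ with $\mathcal W(\nu,\mu)\le\delta$, where $\mathcal W(\nu,\mu)=\inf_\pi\int_{K\times K}d(x,y)\,d\pi(x,y)$, the infimum being over all probability measures $\pi$ on $K\times K$ with marginals $\nu$ and $\mu$. A density is a function $q\in L^1(K,dx)$ with $q\ge 0$ and $\int_K q\,dx=1$; it is identified with the distribution $q\,dx$ (so densities are considered up to equality almost everywhere). Its relative entropy is $H(q,p)=\int_K\log\left(\frac{q(x)}{p(x)}\right)q(x)\,dx\in(-\infty,+\infty]$. Put $\Lambda=\{\lambda\in\mathbb{R}^N:\sum_i\lambda_i=0\}$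 and, for $\lambda\in\mathbb{R}^N$, $\phi_\lambda(x)=\min_{1\le i\le N}\left(d(x,x_i)-\lambda_i\right)$. Then there is a unique density $q^*$ that minimizes $H(q,p)$ over the densities $q\in B_\delta(\mu)$, and it has the form $$q^*(x)=p(x)\exp\left[-1-\overline v\,\phi_{\lambda^*}(x)-\overline u\right]\quad\text{for almost every }x\in K$$ for some $\lambda^*\in\Lambda$ and $(\overline u,\overline v)\in\mathbb{R}^2$. The pair $(\overline u,\overline v)$ in this formula is unique, and $\overline v\ge 0$; if $p\notin B_\delta(\mu)$, then $\lambda^*\in\Lambda$ is unique as well. Moreover, for every $\lambda^*\in\Lambda$ for which the formula holds with this pair, the function $$(u,v)\mapsto -u-v\delta-\int_K p(x)\,e^{-\left(1+v\phi_{\lambda^*}(x)+u\right)}\,dx$$ is strictly concave on $\mathbb{R}^2$, and $(\overline u,\overline v)$ is its unique maximizer over $\{(u,v)\in\mathbb{R}^2: v\ge 0\}$. -/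

import Mathlib

open MeasureTheory
open scoped ENNReal

-- A subset of `ℝⁿ` carries the restriction of Lebesgue measure.
attribute [local instance] MeasureTheory.Measure.Subtype.measureSpace

namespace MinEntropy

/-- A regular compact subset of `ℝⁿ`: the closure of a bounded open set. -/
def IsRegularCompact {n : ℕ} (K : Set (EuclideanSpace ℝ (Fin n))) : Prop :=
  ∃ U : Set (EuclideanSpace ℝ (Fin n)), IsOpen U ∧ Bornology.IsBounded U ∧ K = closure U

/-- `d` satisfies the axioms of a metric on `X`. -/
structure IsMetric {X : Type*} (d : X → X → ℝ) : Prop where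
  eq_zero_iff : ∀ a b, d a b = 0 ↔ a = b
  symm : ∀ a b, d a b = d b a
  triangle : ∀ a b c, d a c ≤ d a b + d b c

/-- `q` is a probability density with respect to the reference measure of `X`. -/
structure IsDensity {X : Type*} [MeasureSpace X] (q : X → ℝ) : Prop where
  integrable : Integrable q volume
  nonneg : ∀ᵐ y ∂(volume : Measure X), 0 ≤ q y
  integral_eq_one : ∫ y, q y = 1

/-- The distribution with density `q`. -/
noncomputable def densityMeasure {X : Type*} [MeasureSpace X] (q : X → ℝ) : Measure X :=
  volume.withDensity fun y => ENNReal.ofReal (q y)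

/-- The empirical measure `(1/N) ∑ᵢ δ_{xᵢ}`. -/
noncomputable def empiricalMeasure {X : Type*} [MeasurableSpace X] {N : ℕ} (x : Fin N → X) :
    Measure X :=
  (N : ℝ≥0∞)⁻¹ • ∑ i, Measure.dirac (x i)

/-- The Wasserstein distance: the infimum of the transport cost `∫ d(a,b) dπ(a,b)` over all
measures `π` on `X × X` with marginals `ν` and `η`. -/
noncomputable def wasserstein {X : Type*} [MeasurableSpace X] (d : X → X → ℝ)
    (ν η : Measure X) : ℝ≥0∞ :=
  ⨅ π ∈ {π : Measure (X × X) | π.map Prod.fst = ν ∧ π.map Prod.snd = η},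
    ∫⁻ z, ENNReal.ofReal (d z.1 z.2) ∂π

/-- The probability distributions at Wasserstein distance at most `δ` from `μ`. -/
def wassersteinBall {X : Type*} [MeasurableSpace X] (d : X → X → ℝ) (μ : Measure X) (δ : ℝ) :
    Set (Measure X) :=
  {ν | IsProbabilityMeasure ν ∧ wasserstein d ν μ ≤ ENNReal.ofReal δ}

open Classical in
/-- The relative entropy `H(q,p) = ∫ log(q/p) q`. The negative part of the integrand is at most
`p/e`, so for densities with `p > 0` the integral always exists in `(-∞, ∞]`, and it is `+∞`
exactly when the integrand is not integrable. -/
noncomputable def relEntropy {X : Type*} [MeasureSpace X] (q p : X → ℝ) : EReal :=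
  if Integrable (fun y => Real.log (q y / p y) * q y) volume then
    ((∫ y, Real.log (q y / p y) * q y : ℝ) : EReal)
  else ⊤

/-- `q` is a density whose distribution lies in the Wasserstein ball of radius `δ` around `μ`. -/
def Feasible {X : Type*} [MeasureSpace X] (d : X → X → ℝ) (μ : Measure X) (δ : ℝ)
    (q : X → ℝ) : Prop :=
  IsDensity q ∧ densityMeasure q ∈ wassersteinBall d μ δ

/-- `q` is a density of minimum relative entropy with respect to `p` in the Wasserstein ball. -/
def IsMinEntropyDensity {X : Type*} [MeasureSpace X] (d : X → X → ℝ) (μ : Measure X) (δ : ℝ)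
    (p q : X → ℝ) : Prop :=
  Feasible d μ δ q ∧ ∀ q' : X → ℝ, Feasible d μ δ q' → relEntropy q p ≤ relEntropy q' p

/-- `φ_l(y) = minᵢ (d(y, xᵢ) - lᵢ)`. -/
noncomputable def phi {X : Type*} {N : ℕ} (d : X → X → ℝ) (x : Fin N → X) (l : Fin N → ℝ)
    (y : X) : ℝ :=
  ⨅ i, (d y (x i) - l i)

/-- The density `p(y) exp(-1 - v φ_l(y) - u)`. -/
noncomputable def gibbs {X : Type*} {N : ℕ} (d : X → X → ℝ) (x : Fin N → X) (p : X → ℝ)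
    (l : Fin N → ℝ) (u v : ℝ) (y : X) : ℝ :=
  p y * Real.exp (-1 - v * phi d x l y - u)

/-- The function `(u, v) ↦ -u - vδ - ∫ p exp(-(1 + v φ_l + u))`. -/
noncomputable def dualObjective {X : Type*} [MeasureSpace X] {N : ℕ} (d : X → X → ℝ)
    (x : Fin N → X) (p : X → ℝ) (δ : ℝ) (l : Fin N → ℝ) (w : ℝ × ℝ) : ℝ :=
  -w.1 - w.2 * δ - ∫ y, p y * Real.exp (-(1 + w.2 * phi d x l y + w.1))

end MinEntropy

/-!
The proof rests on a finite-dimensional convex dual problem. Weak Kantorovich duality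
(`integral_phi_le_of_wasserstein_le`) bounds the mean of `φ_l` by `δ` for every distribution in the
ball and all weights `l` of sum zero. Hence a Gibbs density `g = p exp(-1 - v φ_l - u)` with
`v ≥ 0` which lies in the ball and satisfies `v ∫ g φ_l = v δ` is the unique minimiser: Gibbs'
inequality gives `H(q, p) ≥ -1 - u - v ∫ q φ_l ≥ -1 - u - v δ = H(g, p)` for all competitors `q`,
with equality only for `q = g` (`relEntropy_gibbs_le`). The same complementary slackness and
`exp(-s) ≥ 1 - s` show that `(u, v)` is the unique maximiser of the dual function
(`dualObjective_lt`).

If `p` lies in the ball, then `l = 0`, `u = -1`, `v = 0` will do. Otherwise the parameters come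
from minimising `∫ p exp(-min_i (v d(·, xᵢ) - hᵢ)) + v δ - (1/N) ∑ hᵢ` over `h ∈ ℝ^N` and `v ≥ 0`,
which is coercive because `p` charges the neighbourhoods of all `xᵢ` (`exists_dualCost_min`). At a
minimum with `v > 0`, put `h = v l + c` with `∑ l = 0`. Shifting all `hᵢ`, scaling `v` with `l`
fixed, and raising one `hⱼ` yield in turn total mass one, mean of `φ_l` equal to `δ`, and mass at
least, hence exactly, `1/N` in each Laguerre cell (`optimality_of_min`). Sending each cell to its
centre is then a coupling of cost `δ` (`wasserstein_le_of_cells`). That `v > 0` follows from the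
semi-discrete transport problem for `p` itself (`exists_wasserstein_le_integral_phi`): some `φ_l`
has `p`-mean above `δ`, which makes the dual functional smaller than its infimum `1` over `v = 0`.

Uniqueness of the parameters is a local matter. If all cells have positive mass, the triangle
inequality and the null level sets of `d(·, xᵢ) - d(·, xⱼ)` put each `xⱼ` in the interior of its
own cell, so `φ_l = d(·, xⱼ) - lⱼ` near `xⱼ`. For any weights `l'` this also holds at an index
where `l'` is largest, and comparing two Gibbs densities near that point gives equal `v`. If
`v ≠ 0`, then `φ_l` and `φ_l'` differ by a constant, and comparing them near each `xᵢ` shows that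
`l - l'` is constant (`parameters_unique`).
-/

namespace MinEntropy

/-! ### The potentials `phi` and their Laguerre cells -/

section Phi

variable {X : Type*} {N : ℕ} (d : X → X → ℝ) (x : Fin N → X)
  (l : Fin N → ℝ)

lemma phi_le (i : Fin N) (y : X) : phi d x l y ≤ d y (x i) - l i :=
  ciInf_le (Set.finite_range _).bddBelow i

variable [Nonempty (Fin N)]

lemma exists_phi_eq (y : X) : ∃ i, phi d x l y = d y (x i) - l i := by
  obtain ⟨i, hi⟩ := exists_eq_ciInf_of_finite (f := fun i => d y (x i) - l i)
  exact ⟨i, hi.symm⟩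

lemma le_phi {a : ℝ} {y : X} (h : ∀ i, a ≤ d y (x i) - l i) : a ≤ phi d x l y :=
  le_ciInf h

lemma phi_add_const (c : ℝ) (y : X) : phi d x (fun i => l i + c) y = phi d x l y - c := by
  apply le_antisymm
  · obtain ⟨i, hi⟩ := exists_phi_eq d x l y
    linarith [phi_le d x (fun i => l i + c) i y]
  · refine le_phi _ _ _ fun i => ?_
    linarith [phi_le d x l i y]

lemma phi_mul {v : ℝ} (hv : 0 ≤ v) (y : X) :
    phi (fun a b => v * d a b) x (fun i => v * l i) y = v * phi d x l y := by
  apply le_antisymm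
  · obtain ⟨i, hi⟩ := exists_phi_eq d x l y
    rw [hi, mul_sub]
    exact phi_le (fun a b => v * d a b) x (fun i => v * l i) i y
  · refine le_phi _ _ _ fun i => ?_
    rw [← mul_sub]
    exact mul_le_mul_of_nonneg_left (phi_le d x l i y) hv

lemma scaled_phi_eq (c : ℝ) {v : ℝ} (hv : 0 ≤ v) (y : X) :
    phi (fun a b => v * d a b) x (fun i => v * l i + c) y = v * phi d x l y - c := by
  rw [phi_add_const (fun a b => v * d a b) x (fun i => v * l i), phi_mul d x l hv]

lemma continuous_ciInf_of_finite {Z ι : Type*} [TopologicalSpace Z] [Finite ι] [Nonempty ι]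
    {f : ι → Z → ℝ} (hf : ∀ i, Continuous (f i)) : Continuous fun z => ⨅ i, f i z := by
  have := Fintype.ofFinite ι
  simp_rw [← Finset.inf'_univ_eq_ciInf]
  exact Continuous.finset_inf'_apply _ fun i _ => hf i

/-- The points of the `i`-th Laguerre cell of the weights `l`, up to a slack `t`. -/
def cell (i : Fin N) (t : ℝ) : Set X := {y | d y (x i) - l i - t ≤ phi d x l y}

lemma phi_sub_le_phi_add_single (j : Fin N) {t : ℝ} (ht : 0 ≤ t) (y : X) :
    phi d x l y - t ≤ phi d x (l + Pi.single j t) y := by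
  refine le_phi _ _ _ fun i => ?_
  have := phi_le d x l i y
  rcases eq_or_ne i j with rfl | h
  · simp; linarith
  · simp [h]; linarith

/-- Raising the `j`-th weight by `t` changes `phi` only on the `j`-th cell with slack `t`. -/
lemma phi_le_phi_add_single {j : Fin N} {t : ℝ} {y : X} (hy : y ∉ cell d x l j t) :
    phi d x l y ≤ phi d x (l + Pi.single j t) y := by
  refine le_phi _ _ _ fun i => ?_
  have := phi_le d x l i y
  simp only [cell, Set.mem_ofPred_eq, not_le] at hy
  rcases eq_or_ne i j with rfl | h
  · simp; linarith
  · simp [h]; linarith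

lemma iUnion_cell : ⋃ i, cell d x l i 0 = Set.univ := by
  refine Set.eq_univ_of_forall fun y => ?_
  obtain ⟨i, hi⟩ := exists_phi_eq d x l y
  exact Set.mem_iUnion.2 ⟨i, by simp [cell, hi]⟩

variable [TopologicalSpace X]

lemma continuous_phi {d : X → X → ℝ} (hd : ∀ i, Continuous fun y => d y (x i)) :
    Continuous (phi d x l) :=
  continuous_ciInf_of_finite fun i => (hd i).sub continuous_const

lemma continuous_scaled_phi {d : X → X → ℝ} (hd : ∀ i, Continuous fun y => d y (x i))
    (v : ℝ) :
    Continuous (phi (fun a b => v * d a b) x l) :=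
  continuous_phi x l fun i => continuous_const.mul (hd i)

lemma isClosed_cell {d : X → X → ℝ} (hd : ∀ i, Continuous fun y => d y (x i)) (j : Fin N) (t : ℝ) :
    IsClosed (cell d x l j t) :=
  isClosed_le (((hd j).sub continuous_const).sub continuous_const) (continuous_phi x l hd)

end Phi

lemma IsMetric.nonneg {X : Type*} {d : X → X → ℝ} (hd : IsMetric d) (a b : X) : 0 ≤ d a b := by
  have h1 := hd.triangle a b a
  have h2 := (hd.eq_zero_iff a a).2 rfl
  have h3 := hd.symm a b
  linarith

lemma IsMetric.pos {X : Type*} {d : X → X → ℝ} (hd : IsMetric d) {a b : X} (h : a ≠ b) :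
    0 < d a b :=
  (hd.nonneg a b).lt_of_ne fun h0 => h ((hd.eq_zero_iff a b).1 h0.symm)

/-! ### Densities and the measures they define -/

section Density

variable {X : Type*} [MeasureSpace X] {q : X → ℝ}

lemma IsDensity.isProbabilityMeasure (hq : IsDensity q) :
    IsProbabilityMeasure (densityMeasure q) := by
  constructor
  rw [densityMeasure, withDensity_apply _ MeasurableSet.univ, Measure.restrict_univ,
    ← ofReal_integral_eq_lintegral_ofReal hq.integrable hq.nonneg, hq.integral_eq_one,
    ENNReal.ofReal_one]

lemma IsDensity.integral_densityMeasure (hq : IsDensity q) (f : X → ℝ) :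
    ∫ y, f y ∂densityMeasure q = ∫ y, q y * f y := by
  rw [densityMeasure, integral_withDensity_eq_integral_toReal_smul₀
    hq.integrable.aemeasurable.ennreal_ofReal (by simp)]
  refine integral_congr_ae ?_
  filter_upwards [hq.nonneg] with y hy
  rw [ENNReal.toReal_ofReal hy, smul_eq_mul]

lemma IsDensity.measureReal_eq (hq : IsDensity q) {s : Set X} (hs : MeasurableSet s) :
    (densityMeasure q).real s = ∫ y, q y * s.indicator 1 y := by
  rw [← hq.integral_densityMeasure, integral_indicator_one hs]

lemma densityMeasure_absolutelyContinuous (q : X → ℝ) : densityMeasure q ≪ volume :=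
  withDensity_absolutelyContinuous _ _

end Density

/-! ### Kantorovich duality for a finitely supported target -/

section Transport

variable {X : Type*} [MeasurableSpace X] {N : ℕ} {d : X → X → ℝ}
  {x : Fin N → X} {l : Fin N → ℝ} {ν : Measure X}

lemma ofReal_integral_le_lintegral {Y : Type*} [MeasurableSpace Y] {π : Measure Y} {f : Y → ℝ}
    (hf : Integrable f π) : ENNReal.ofReal (∫ z, f z ∂π) ≤ ∫⁻ z, ENNReal.ofReal (f z) ∂π := by
  rw [integral_eq_lintegral_pos_part_sub_lintegral_neg_part hf]
  refine le_trans (ENNReal.ofReal_le_ofReal (sub_le_self _ ENNReal.toReal_nonneg)) ?_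
  exact ENNReal.ofReal_toReal_le

/-- Weak Kantorovich duality: `phi` and the weights form an admissible pair of dual potentials, and
the weights have mean zero. -/
lemma integral_phi_le_of_wasserstein_le [MeasurableSingletonClass X] [Nonempty (Fin N)]
    (hx : Function.Injective x) (hl : ∑ i, l i = 0)
    [IsProbabilityMeasure ν] (hφ : Integrable (phi d x l) ν) {δ : ℝ} (hδ : 0 ≤ δ)
    (hW : wasserstein d ν (empiricalMeasure x) ≤ ENNReal.ofReal δ) :
    ∫ y, phi d x l y ∂ν ≤ δ := by
  rw [← ENNReal.ofReal_le_ofReal_iff hδ]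
  refine le_trans (le_iInf₂ fun π hπ => ?_) hW
  obtain ⟨h1, h2⟩ := hπ
  have hπp : IsProbabilityMeasure π := by
    have : IsProbabilityMeasure (π.map Prod.fst) := by rw [h1]; infer_instance
    exact Measure.isProbabilityMeasure_of_map Prod.fst
  -- extends the weights to a function on `X`, so that they can be integrated against `π`
  set w : X → ℝ := fun b => ∑ i, ({x i} : Set X).indicator (fun _ => l i) b with hw
  have hwx : ∀ i, w (x i) = l i := fun i => by
    rw [hw]
    dsimp only
    rw [Finset.sum_eq_single i]
    · simp
    · intro j _ hj
      simp [hx.ne hj.symm]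
    · simp
  have hwm : Measurable w :=
    Finset.measurable_sum _ fun i _ => measurable_const.indicator (measurableSet_singleton _)
  have hwi : ∀ m : Measure X, IsFiniteMeasure m → Integrable w m := fun m _ =>
    integrable_finsetSum _ fun i _ => (integrable_const _).indicator (measurableSet_singleton _)
  clear_value w
  have hη : IsFiniteMeasure (empiricalMeasure x) := by rw [← h2]; infer_instance
  have hw0 : ∫ z, w z.2 ∂π = 0 := by
    rw [← integral_map measurable_snd.aemeasurable hwm.aestronglyMeasurable, h2,
      empiricalMeasure, integral_smul_measure, integral_finsetSum_measure]
    · simp [integral_dirac, hwx, hl]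
    · intro i _
      exact hwi _ inferInstance
  have hφ1 : ∫ z, phi d x l z.1 ∂π = ∫ y, phi d x l y ∂ν := by
    rw [← h1, integral_map measurable_fst.aemeasurable]
    rw [h1]; exact hφ.aestronglyMeasurable
  have hφi : Integrable (fun z : X × X => phi d x l z.1) π := by
    rw [← h1] at hφ
    exact hφ.comp_measurable measurable_fst
  have hwi2 : Integrable (fun z : X × X => w z.2) π :=
    (h2 ▸ hwi _ hη : Integrable w (π.map Prod.snd)).comp_measurable measurable_snd
  have hgi : Integrable (fun z : X × X => phi d x l z.1 + w z.2) π := hφi.add hwi2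
  have hsum : ∫ y, phi d x l y ∂ν = ∫ z, (phi d x l z.1 + w z.2) ∂π := by
    rw [integral_add hφi hwi2, hw0, hφ1, add_zero]
  have hae : ∀ᵐ z ∂π, z.2 ∈ Set.range x := by
    refine ae_of_ae_map (p := fun b => b ∈ Set.range x) measurable_snd.aemeasurable ?_
    rw [h2, ae_iff]
    simp [empiricalMeasure]
  calc ENNReal.ofReal (∫ y, phi d x l y ∂ν)
      ≤ ∫⁻ z, ENNReal.ofReal (phi d x l z.1 + w z.2) ∂π := by
        rw [hsum]
        exact ofReal_integral_le_lintegral hgi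
    _ ≤ _ := by
        refine lintegral_mono_ae ?_
        filter_upwards [hae] with z hz
        obtain ⟨i, hi⟩ := hz
        refine ENNReal.ofReal_le_ofReal ?_
        rw [← hi, hwx]
        linarith [phi_le d x l i z.1]

/-- If every Laguerre cell has mass at least `1 / N`, then all masses are `1 / N`, because the cells
overlap in null sets, and sending each cell to its centre is a coupling with the empirical
measure. -/
lemma wasserstein_le_of_cells [Nonempty (Fin N)]
    (hm : ∀ i, MeasurableSet (cell d x l i 0))
    (hx : ∀ i j, i ≠ j → ∀ t : ℝ, ν {y | d y (x i) - d y (x j) = t} = 0)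
    (hl : ∑ i, l i = 0) [IsProbabilityMeasure ν] (hφ : Integrable (phi d x l) ν)
    (hd0 : ∀ a b, 0 ≤ d a b) (hc : ∀ i, (N : ℝ)⁻¹ ≤ ν.real (cell d x l i 0)) :
    wasserstein d ν (empiricalMeasure x) ≤ ENNReal.ofReal (∫ y, phi d x l y ∂ν) := by
  have hN : (N : ℝ) ≠ 0 := by
    have := Fin.pos_iff_nonempty.2 ‹Nonempty (Fin N)›
    positivity
  have hφc : ∀ i, ∀ y ∈ cell d x l i 0, phi d x l y = d y (x i) - l i := fun i y hy =>
    le_antisymm (phi_le d x l i y) (by simpa [cell] using hy)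
  have hdis : Pairwise (Function.onFun (AEDisjoint ν) fun i => cell d x l i 0) := by
    intro i j hij
    refine measure_mono_null ?_ (hx i j hij (l i - l j))
    intro y hy
    have h1 := hφc i y hy.1
    have h2 := hφc j y hy.2
    simp only [Set.mem_ofPred_eq]
    linarith
  have hsum : Measure.sum (fun i => ν.restrict (cell d x l i 0)) = ν := by
    rw [← Measure.restrict_iUnion_ae hdis fun i => (hm i).nullMeasurableSet, iUnion_cell,
      Measure.restrict_univ]
  have hmass : ∀ i, ν.real (cell d x l i 0) = (N : ℝ)⁻¹ := by
    have htot : ∑ i, ν.real (cell d x l i 0) = 1 := by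
      have h := congrArg (fun m : Measure X => m.real Set.univ) hsum
      simp only [Measure.sum_fintype, probReal_univ] at h
      rw [← h]
      simp [Measure.real, ENNReal.toReal_sum]
    have h0 : ∑ i, (ν.real (cell d x l i 0) - (N : ℝ)⁻¹) = 0 := by
      rw [Finset.sum_sub_distrib, htot]
      simp [hN]
    intro i
    have := (Finset.sum_eq_zero_iff_of_nonneg fun i _ => sub_nonneg.2 (hc i)).1 h0 i
      (Finset.mem_univ i)
    linarith
  have hmass' : ∀ i, ν (cell d x l i 0) = (N : ℝ≥0∞)⁻¹ := fun i => by
    rw [← ENNReal.ofReal_toReal (measure_ne_top ν _), ← Measure.real, hmass,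
      ENNReal.ofReal_inv_of_pos (by positivity), ENNReal.ofReal_natCast]
  have hmk : ∀ i, Measurable fun y : X => (y, x i) := fun i => measurable_id.prodMk measurable_const
  set π : Measure (X × X) :=
    Measure.sum fun i => (ν.restrict (cell d x l i 0)).map fun y => (y, x i) with hπ
  have h1 : π.map Prod.fst = ν := by
    rw [hπ, Measure.map_sum measurable_fst.aemeasurable]
    simp_rw [Measure.map_map measurable_fst (hmk _), Function.comp_def, Measure.map_id']
    exact hsum
  have h2 : π.map Prod.snd = empiricalMeasure x := by
    rw [hπ, Measure.map_sum measurable_snd.aemeasurable]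
    simp_rw [Measure.map_map measurable_snd (hmk _), Function.comp_def, Measure.map_const,
      Measure.restrict_apply_univ, hmass']
    rw [Measure.sum_fintype, empiricalMeasure, Finset.smul_sum]
  refine (iInf₂_le π ⟨h1, h2⟩).trans ?_
  have hint : ∀ i, Integrable (fun y => d y (x i)) (ν.restrict (cell d x l i 0)) := fun i => by
    refine (hφ.restrict.add (integrable_const (l i))).congr ?_
    filter_upwards [ae_restrict_mem (hm i)] with y hy
    simp [hφc i y hy]
  calc ∫⁻ z, ENNReal.ofReal (d z.1 z.2) ∂π
      = ∑ i, ∫⁻ z, ENNReal.ofReal (d z.1 z.2)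
          ∂(ν.restrict (cell d x l i 0)).map fun y => (y, x i) := by
        rw [hπ, Measure.sum_fintype, lintegral_finsetSum_measure]
    _ ≤ ∑ i, ∫⁻ y, ENNReal.ofReal (d y (x i)) ∂ν.restrict (cell d x l i 0) :=
        Finset.sum_le_sum fun i _ => lintegral_map_le _ _
    _ = ENNReal.ofReal (∑ i, ∫ y in cell d x l i 0, d y (x i) ∂ν) := by
        rw [ENNReal.ofReal_sum_of_nonneg fun i _ => integral_nonneg fun y => hd0 _ _]
        refine Finset.sum_congr rfl fun i _ => ?_
        rw [ofReal_integral_eq_lintegral_ofReal (hint i) (.of_forall fun y => hd0 _ _)]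
    _ = ENNReal.ofReal (∫ y, phi d x l y ∂ν) := by
        congr 1
        have : ∀ i, ∫ y in cell d x l i 0, d y (x i) ∂ν
            = ∫ y in cell d x l i 0, phi d x l y ∂ν + (N : ℝ)⁻¹ * l i := fun i => by
          have h : ∫ y in cell d x l i 0, d y (x i) ∂ν
              = ∫ y in cell d x l i 0, (phi d x l y + l i) ∂ν := by
            refine setIntegral_congr_fun (hm i) fun y hy => ?_
            simp [hφc i y hy]
          rw [h, integral_add hφ.restrict (integrable_const _)]
          simp [hmass]
        simp_rw [this]
        rw [Finset.sum_add_distrib, ← Finset.mul_sum, hl, mul_zero, add_zero]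
        conv_rhs => rw [← hsum]
        rw [Measure.sum_fintype, integral_finsetSum_measure fun i _ => hφ.restrict]

end Transport

/-! ### Uniqueness of the parameters -/

section Parameters

open Filter Topology

variable {X : Type*} {N : ℕ} {d : X → X → ℝ} {x : Fin N → X} {l l' : Fin N → ℝ} {p : X → ℝ}
  {u v u' v' : ℝ}

lemma log_gibbs_div (hp0 : ∀ y, 0 < p y) (y : X) :
    Real.log (gibbs d x p l u v y / p y) = -1 - v * phi d x l y - u := by
  rw [gibbs, mul_div_cancel_left₀ _ (hp0 y).ne', Real.log_exp]

lemma injective_of_measure_level_eq_zero [TopologicalSpace X] [MeasureSpace X]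
    [(volume : Measure X).IsOpenPosMeasure] [Nonempty X]
    (hx : ∀ i j, i ≠ j → ∀ t : ℝ, volume {y : X | d y (x i) - d y (x j) = t} = 0) :
    Function.Injective x := by
  intro i j hij
  by_contra hne
  have := hx i j hne 0
  simp only [hij, sub_self, Set.ofPred_true] at this
  exact (isOpen_univ.measure_pos volume Set.univ_nonempty).ne' this

/-- A centre whose cell is not negligible lies in the interior of its cell: otherwise the triangle
inequality puts the cell into the boundary with another one. -/
lemma sub_lt_dist_of_measure_cell_pos [MeasureSpace X] (hd : IsMetric d)
    (hx : ∀ i j, i ≠ j → ∀ t : ℝ, volume {y : X | d y (x i) - d y (x j) = t} = 0) {j : Fin N}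
    (hj : volume (cell d x l j 0) ≠ 0) (i : Fin N) (hij : i ≠ j) :
    l i - l j < d (x j) (x i) := by
  by_contra! hcon
  refine hj (measure_mono_null (fun y hy => ?_) (hx i j hij (l i - l j)))
  have h1 : d y (x j) - l j - 0 ≤ phi d x l y := hy
  have h2 := phi_le d x l i y
  have h3 := hd.triangle y (x j) (x i)
  simp only [Set.mem_ofPred_eq]
  linarith

variable [Nonempty (Fin N)]

lemma exists_sub_lt_dist (hd : IsMetric d) (hinj : Function.Injective x) (l : Fin N → ℝ) :
    ∃ j, ∀ i, i ≠ j → l i - l j < d (x j) (x i) := by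
  obtain ⟨j, hj⟩ := Finite.exists_max l
  refine ⟨j, fun i hi => ?_⟩
  have := hd.pos (hinj.ne hi.symm)
  linarith [hj i]

variable [TopologicalSpace X]

lemma continuous_gibbs (hdi : ∀ i, Continuous fun y => d y (x i)) (hpc : Continuous p) :
    Continuous (gibbs d x p l u v) := by
  have := continuous_phi x l hdi
  unfold gibbs
  fun_prop

lemma eventually_phi_eq (hd : IsMetric d) (hdi : ∀ i, Continuous fun y => d y (x i)) {j : Fin N}
    (h : ∀ i, i ≠ j → l i - l j < d (x j) (x i)) :
    ∀ᶠ y in 𝓝 (x j), phi d x l y = d y (x j) - l j := by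
  have key : ∀ i, ∀ᶠ y in 𝓝 (x j), d y (x j) - l j ≤ d y (x i) - l i := by
    intro i
    rcases eq_or_ne i j with rfl | hij
    · simp
    · have hlt : d (x j) (x j) - l j < d (x j) (x i) - l i := by
        have := h i hij
        rw [(hd.eq_zero_iff _ _).2 rfl]
        linarith
      filter_upwards [(((hdi j).sub continuous_const).tendsto (x j)).eventually_lt
        (((hdi i).sub continuous_const).tendsto (x j)) hlt] with y hy
      exact hy.le
  filter_upwards [eventually_all.2 key] with y hy
  exact le_antisymm (phi_le d x l j y) (le_phi d x l hy)

variable [MeasureSpace X] [(volume : Measure X).IsOpenPosMeasure]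
  [NullSingletonClass (volume : Measure X)]

/-- Near `x j` both sides are affine in the distance to `x j`, which takes the value `0` and
nonzero values there. -/
lemma affine_phi_eq (hd : IsMetric d) (hdi : ∀ i, Continuous fun y => d y (x i)) {j : Fin N}
    (h : ∀ i, i ≠ j → l i - l j < d (x j) (x i)) (h' : ∀ i, i ≠ j → l' i - l' j < d (x j) (x i))
    (heq : ∀ y, v * phi d x l y + u = v' * phi d x l' y + u') :
    v' = v ∧ u - v * l j = u' - v * l' j := by
  have hev := (eventually_phi_eq hd hdi h).and (eventually_phi_eq hd hdi h')
  obtain ⟨y, ⟨hy, hy'⟩, hne⟩ : ∃ y, (phi d x l y = d y (x j) - l j ∧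
      phi d x l' y = d y (x j) - l' j) ∧ y ≠ x j := by
    by_contra! hcon
    refine (Measure.measure_pos_of_mem_nhds (volume : Measure X) hev).ne' ?_
    exact measure_mono_null (fun y hy => hcon y hy) (measure_singleton (x j))
  have hv : v' = v := by
    have h0 := heq (x j)
    have h1 := heq y
    obtain ⟨e, e'⟩ := hev.self_of_nhds
    rw [e, e', (hd.eq_zero_iff _ _).2 rfl] at h0
    rw [hy, hy'] at h1
    have : (v' - v) * d y (x j) = 0 := by linarith
    rcases mul_eq_zero.1 this with h2 | h2
    · linarith
    · exact absurd h2 (hd.pos hne).ne'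
  refine ⟨hv, ?_⟩
  have h1 := heq y
  rw [hy, hy', hv] at h1
  linarith

/-- For weights whose cells contain their centres in the interior, an affine function of `phi`
determines its coefficients, and the weights too unless it is constant. -/
lemma parameters_unique (hd : IsMetric d) (hdi : ∀ i, Continuous fun y => d y (x i))
    (hinj : Function.Injective x)
    (hx : ∀ i j, i ≠ j → ∀ t : ℝ, volume {y : X | d y (x i) - d y (x j) = t} = 0)
    (hl : ∑ i, l i = 0) (hl' : ∑ i, l' i = 0)
    (h : ∀ i j, i ≠ j → l i - l j < d (x j) (x i))
    (heq : ∀ y, v * phi d x l y + u = v' * phi d x l' y + u') :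
    u' = u ∧ v' = v ∧ (v ≠ 0 → l' = l) := by
  obtain ⟨j, hj⟩ := exists_sub_lt_dist hd hinj l'
  obtain ⟨rfl, -⟩ := affine_phi_eq hd hdi (fun i => h i j) hj heq
  rcases eq_or_ne v' 0 with rfl | hv
  · have := heq (x j)
    refine ⟨by linarith, rfl, fun h => absurd rfl h⟩
  set c := (u - u') / v' with hc
  have hcv : v' * c = u - u' := by rw [hc]; field_simp
  have hphi : ∀ y, phi d x l' y = phi d x l y + c := fun y => by
    have := heq y
    apply mul_left_cancel₀ hv
    rw [mul_add, hcv]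
    linarith
  have hlc : ∀ i, l i - l' i = c := by
    intro i
    have hev := eventually_phi_eq hd hdi (fun k => h k i)
    by_contra hne
    refine (Measure.measure_pos_of_mem_nhds (volume : Measure X) hev).ne' ?_
    refine measure_mono_null (t := ⋃ k ∈ {k | k ≠ i},
      {y : X | d y (x k) - d y (x i) = l' k - l i + c}) (fun y hy => ?_)
      ((measure_biUnion_null_iff (Set.to_countable _)).2 fun k hk => hx k i hk _)
    obtain ⟨k, hk⟩ := exists_phi_eq d x l' y
    have hyi : phi d x l y = d y (x i) - l i := hy
    have h1 := hphi y
    rw [hk, hyi] at h1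
    have hki : k ≠ i := by
      rintro rfl
      exact hne (by linarith)
    simp only [Set.mem_iUnion, Set.mem_ofPred_eq]
    exact ⟨k, hki, by linarith⟩
  have hc0 : c = 0 := by
    have hs : ∑ i, (l i - l' i) = N * c := by simp [hlc]
    rw [Finset.sum_sub_distrib, hl, hl', sub_zero] at hs
    have := Fin.pos_iff_nonempty.2 ‹Nonempty (Fin N)›
    have hN : (N : ℝ) ≠ 0 := by positivity
    simpa [hN] using hs.symm
  refine ⟨by rw [hc0] at hcv; linarith, rfl, fun _ => funext fun i => ?_⟩
  linarith [hlc i]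

end Parameters

/-! ### Sufficiency of the optimality conditions -/

section Analysis

lemma exists_bound_of_continuous {X : Type*} [TopologicalSpace X] [CompactSpace X] {f : X → ℝ}
    (hf : Continuous f) : ∃ M > 0, ∀ y, |f y| ≤ M := by
  obtain ⟨C, hC⟩ := isCompact_univ.exists_bound_of_continuousOn hf.continuousOn
  exact ⟨max C 1, by positivity, fun y => (hC y (Set.mem_univ y)).trans (le_max_left _ _)⟩

variable {X : Type*} [TopologicalSpace X] [CompactSpace X] [MeasureSpace X] [BorelSpace X]

lemma integrable_of_continuous {f : X → ℝ} (hf : Continuous f) (ν : Measure X)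
    [IsFiniteMeasure ν] : Integrable f ν :=
  hf.integrable_of_hasCompactSupport (.of_compactSpace f)

lemma integral_pos_of_continuous [IsFiniteMeasure (volume : Measure X)]
    [(volume : Measure X).IsOpenPosMeasure] {f : X → ℝ}
    (hf : Continuous f) (h0 : ∀ y, 0 ≤ f y) {a : X} (ha : f a ≠ 0) : 0 < ∫ y, f y :=
  hf.integral_pos_of_hasCompactSupport_nonneg_nonzero (.of_compactSpace f) h0 ha

lemma IsDensity.integrable_mul {q f : X → ℝ} (hq : IsDensity q) (hf : Continuous f) :
    Integrable fun y => q y * f y := by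
  obtain ⟨C, hC⟩ := isCompact_univ.exists_bound_of_continuousOn hf.continuousOn
  exact hq.integrable.mul_bdd (c := C) hf.measurable.aestronglyMeasurable
    (.of_forall fun y => hC y (Set.mem_univ y))

lemma integral_mul_exp_le {q φ : X → ℝ} (hq : IsDensity q) (hφ : Continuous φ) {M : ℝ}
    (hM : ∀ y, |φ y| ≤ M) {s : ℝ} (hs : |s| * M ≤ 1) :
    ∫ y, q y * Real.exp (-s * φ y) ≤ 1 - s * (∫ y, q y * φ y) + s ^ 2 * M ^ 2 := by
  have i1 := hq.integrable_mul hφ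
  have i2 := hq.integrable_mul (f := fun y => Real.exp (-s * φ y)) (by fun_prop)
  have i3 : Integrable fun y => (1 + s ^ 2 * M ^ 2) * q y := hq.integrable.const_mul _
  have h : ∫ y, q y * Real.exp (-s * φ y)
      ≤ ∫ y, ((1 + s ^ 2 * M ^ 2) * q y - s * (q y * φ y)) := by
    refine integral_mono_ae i2 (i3.sub (i1.const_mul s)) ?_
    filter_upwards [hq.nonneg] with y hy
    have hle : |-s * φ y| ≤ |s| * M := by
      rw [abs_mul, abs_neg]
      exact mul_le_mul_of_nonneg_left (hM y) (abs_nonneg s)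
    have h1 := (abs_le.1 (Real.abs_exp_sub_one_sub_id_le (hle.trans hs))).2
    have h2 : (-s * φ y) ^ 2 ≤ s ^ 2 * M ^ 2 := by
      rw [← sq_abs, ← sq_abs s, ← mul_pow]
      exact pow_le_pow_left₀ (abs_nonneg _) hle 2
    have := mul_le_mul_of_nonneg_left
      (show Real.exp (-s * φ y) ≤ 1 + s ^ 2 * M ^ 2 - s * φ y by linarith) hy
    linarith
  rw [integral_sub i3 (i1.const_mul s), integral_const_mul, integral_const_mul,
    hq.integral_eq_one] at h
  linarith

/-- The pointwise form of Gibbs' inequality. -/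
lemma mul_log_add_sub_le {a q p : ℝ} (ha : 0 ≤ a) (hq : 0 < q) (hp : 0 < p) :
    a * Real.log (q / p) + a - q ≤ Real.log (a / p) * a := by
  rcases ha.eq_or_lt with rfl | ha
  · simp; exact hq.le
  · have h := Real.log_le_sub_one_of_pos (div_pos hq ha)
    rw [Real.log_div hq.ne' ha.ne'] at h
    rw [Real.log_div hq.ne' hp.ne', Real.log_div ha.ne' hp.ne']
    have := mul_le_mul_of_nonneg_left h ha.le
    rw [mul_sub a (q / a), mul_div_cancel₀ _ ha.ne'] at this
    linarith

lemma mul_log_add_sub_lt {a q p : ℝ} (ha : 0 ≤ a) (hq : 0 < q) (hp : 0 < p) (hne : a ≠ q) :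
    a * Real.log (q / p) + a - q < Real.log (a / p) * a := by
  rcases ha.eq_or_lt with rfl | ha
  · simp; exact hq
  · have h := Real.log_lt_sub_one_of_pos (div_pos hq ha) (by
      intro h; rw [div_eq_one_iff_eq ha.ne'] at h; exact hne h.symm)
    rw [Real.log_div hq.ne' ha.ne'] at h
    rw [Real.log_div hq.ne' hp.ne', Real.log_div ha.ne' hp.ne']
    have := mul_lt_mul_of_pos_left h ha
    rw [mul_sub a (q / a), mul_div_cancel₀ _ ha.ne'] at this
    linarith

variable {N : ℕ} [Nonempty (Fin N)] {d : X → X → ℝ} {x : Fin N → X} {l : Fin N → ℝ} {p : X → ℝ}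
  {u v δ : ℝ}

lemma IsDensity.integral_mul_log_gibbs {q : X → ℝ} (hq : IsDensity q)
    (hdi : ∀ i, Continuous fun y => d y (x i)) (hp0 : ∀ y, 0 < p y) :
    Integrable (fun y => q y * Real.log (gibbs d x p l u v y / p y)) ∧
    ∫ y, q y * Real.log (gibbs d x p l u v y / p y) = -1 - u - v * ∫ y, q y * phi d x l y := by
  have hφ := continuous_phi x l hdi
  have e : (fun y => q y * Real.log (gibbs d x p l u v y / p y))
      = fun y => (-1 - u) * q y - v * (q y * phi d x l y) := by
    funext y
    rw [log_gibbs_div hp0]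
    ring
  rw [e]
  have i1 := hq.integrable.const_mul (-1 - u)
  have i2 := (hq.integrable_mul hφ).const_mul v
  refine ⟨i1.sub i2, ?_⟩
  rw [integral_sub i1 i2, integral_const_mul, integral_const_mul, hq.integral_eq_one, mul_one]

variable [IsFiniteMeasure (volume : Measure X)]

lemma isDensity_gibbs (hdi : ∀ i, Continuous fun y => d y (x i)) (hpc : Continuous p)
    (hp0 : ∀ y, 0 < p y) (h1 : ∫ y, gibbs d x p l u v y = 1) :
    IsDensity (gibbs d x p l u v) :=
  ⟨integrable_of_continuous (continuous_gibbs hdi hpc) _,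
    .of_forall fun y => (mul_pos (hp0 y) (Real.exp_pos _)).le, h1⟩

lemma relEntropy_gibbs (hdi : ∀ i, Continuous fun y => d y (x i)) (hpc : Continuous p)
    (hp0 : ∀ y, 0 < p y) (h1 : ∫ y, gibbs d x p l u v y = 1) :
    relEntropy (gibbs d x p l u v) p =
      ((-1 - u - v * ∫ y, gibbs d x p l u v y * phi d x l y : ℝ) : EReal) := by
  obtain ⟨i, e⟩ := (isDensity_gibbs hdi hpc hp0 h1).integral_mul_log_gibbs (u := u) (v := v)
    (l := l) hdi hp0
  simp_rw [mul_comm _ (Real.log _)] at i e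
  rw [relEntropy, if_pos i, e]

/-- The Gibbs density minimises the entropy among the densities with the same or a smaller mean
of `v * phi`, and is the only minimiser. -/
lemma relEntropy_gibbs_le (hdi : ∀ i, Continuous fun y => d y (x i)) (hpc : Continuous p)
    (hp0 : ∀ y, 0 < p y) (h1 : ∫ y, gibbs d x p l u v y = 1) {q : X → ℝ} (hq : IsDensity q)
    (hle : v * ∫ y, q y * phi d x l y ≤ v * ∫ y, gibbs d x p l u v y * phi d x l y) :
    relEntropy (gibbs d x p l u v) p ≤ relEntropy q p ∧
    (relEntropy q p ≤ relEntropy (gibbs d x p l u v) p → q =ᵐ[volume] gibbs d x p l u v) := by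
  rw [relEntropy_gibbs hdi hpc hp0 h1]
  set g := gibbs d x p l u v with hg
  have hgp : ∀ y, 0 < g y := fun y => mul_pos (hp0 y) (Real.exp_pos _)
  have hgd : IsDensity g := isDensity_gibbs hdi hpc hp0 h1
  rw [relEntropy]
  split_ifs with hi
  swap
  · exact ⟨le_top, fun h => absurd (top_le_iff.1 h) (EReal.coe_ne_top _)⟩
  obtain ⟨i1, e1⟩ := hq.integral_mul_log_gibbs (u := u) (v := v) (l := l) hdi hp0
  have i2 : Integrable fun y => q y * Real.log (g y / p y) + q y - g y :=
    (i1.add hq.integrable).sub hgd.integrable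
  have e2 : ∫ y, (q y * Real.log (g y / p y) + q y - g y) = -1 - u - v * ∫ y, q y * phi d x l y := by
    rw [integral_sub (f := fun y => q y * Real.log (g y / p y) + q y) (i1.add hq.integrable)
      hgd.integrable, integral_add i1 hq.integrable, hq.integral_eq_one, h1, e1]
    ring
  have hmono := integral_mono_ae i2 hi (by
    filter_upwards [hq.nonneg] with y hy using mul_log_add_sub_le hy (hgp y) (hp0 y))
  rw [e2] at hmono
  simp only [EReal.coe_le_coe_iff]
  refine ⟨by linarith, fun hle' => ?_⟩
  have h0 : ∫ y, (Real.log (q y / p y) * q y - (q y * Real.log (g y / p y) + q y - g y)) = 0 := by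
    rw [integral_sub hi i2, e2]
    linarith
  rw [integral_eq_zero_iff_of_nonneg_ae (f := fun y =>
    Real.log (q y / p y) * q y - (q y * Real.log (g y / p y) + q y - g y)) ?_ (hi.sub i2)] at h0
  · filter_upwards [h0, hq.nonneg] with y hy hy0
    by_contra hne
    have := mul_log_add_sub_lt hy0 (hgp y) (hp0 y) hne
    simp only [Pi.zero_apply] at hy
    linarith
  · filter_upwards [hq.nonneg] with y hy
    have := mul_log_add_sub_le hy (hgp y) (hp0 y)
    simp only [Pi.zero_apply]
    linarith

variable [(volume : Measure X).IsOpenPosMeasure] [NullSingletonClass (volume : Measure X)]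

lemma strictConcaveOn_dualObjective (hd : IsMetric d) (hdi : ∀ i, Continuous fun y => d y (x i))
    (hinj : Function.Injective x) (hpc : Continuous p) (hp0 : ∀ y, 0 < p y) (l : Fin N → ℝ) :
    StrictConcaveOn ℝ Set.univ (dualObjective d x p δ l) := by
  refine ⟨convex_univ, fun w _ w' _ hne a b ha hb hab => ?_⟩
  have hφ := continuous_phi x l hdi
  have hc : ∀ z : ℝ × ℝ, Continuous fun y => p y * Real.exp (-(1 + z.2 * phi d x l y + z.1)) :=
    fun z => by fun_prop
  have hi := fun z => integrable_of_continuous (hc z) (volume : Measure X)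
  obtain ⟨y₀, hy₀⟩ : ∃ y, w.2 * phi d x l y + w.1 ≠ w'.2 * phi d x l y + w'.1 := by
    by_contra! hcon
    obtain ⟨j, hj⟩ := exists_sub_lt_dist hd hinj l
    obtain ⟨h2, h1⟩ := affine_phi_eq hd hdi hj hj hcon
    exact hne (Prod.ext (by linarith) h2.symm)
  set A := fun y => p y * Real.exp (-(1 + w.2 * phi d x l y + w.1))
  set B := fun y => p y * Real.exp (-(1 + w'.2 * phi d x l y + w'.1))
  set z := a • w + b • w' with hz
  set C := fun y => p y * Real.exp (-(1 + z.2 * phi d x l y + z.1))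
  have hz1 : z.1 = a * w.1 + b * w'.1 := by simp [hz]
  have hz2 : z.2 = a * w.2 + b * w'.2 := by simp [hz]
  have hCe : ∀ y, -(1 + z.2 * phi d x l y + z.1) =
      a * (-(1 + w.2 * phi d x l y + w.1)) + b * (-(1 + w'.2 * phi d x l y + w'.1)) := fun y => by
    rw [hz1, hz2]
    linear_combination (-1 : ℝ) * hab.symm
  have hnn : ∀ y, 0 ≤ a * A y + b * B y - C y := fun y => by
    have h := convexOn_exp.2 (Set.mem_univ (-(1 + w.2 * phi d x l y + w.1)))
      (Set.mem_univ (-(1 + w'.2 * phi d x l y + w'.1))) ha.le hb.le hab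
    simp only [smul_eq_mul, ← hCe] at h
    have := mul_le_mul_of_nonneg_left h (hp0 y).le
    simp only [A, B, C]
    linarith
  have hpos : a * A y₀ + b * B y₀ - C y₀ ≠ 0 := by
    have h := strictConvexOn_exp.2 (Set.mem_univ (-(1 + w.2 * phi d x l y₀ + w.1)))
      (Set.mem_univ (-(1 + w'.2 * phi d x l y₀ + w'.1))) (fun h => hy₀ (by linarith)) ha hb hab
    simp only [smul_eq_mul, ← hCe] at h
    have := mul_lt_mul_of_pos_left h (hp0 y₀)
    simp only [A, B, C]
    refine ne_of_gt ?_
    linarith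
  have hcont : Continuous fun y => a * A y + b * B y - C y :=
    ((continuous_const.mul (hc w)).add (continuous_const.mul (hc w'))).sub (hc z)
  have hlt := integral_pos_of_continuous hcont hnn hpos
  have iA : Integrable fun y => a * A y := (hi w).const_mul a
  have iB : Integrable fun y => b * B y := (hi w').const_mul b
  rw [integral_sub (f := fun y => a * A y + b * B y) (iA.add iB) (hi z), integral_add iA iB,
    integral_const_mul, integral_const_mul] at hlt
  simp only [dualObjective, smul_eq_mul]
  change a * (-w.1 - w.2 * δ - ∫ y, A y) + b * (-w'.1 - w'.2 * δ - ∫ y, B y)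
    < -z.1 - z.2 * δ - ∫ y, C y
  rw [hz1, hz2]
  linarith

/-- Complementary slackness makes `(u, v)` the unique maximiser, by `exp (-s) ≥ 1 - s`. -/
lemma dualObjective_lt (hd : IsMetric d) (hdi : ∀ i, Continuous fun y => d y (x i))
    (hinj : Function.Injective x) (hpc : Continuous p) (hp0 : ∀ y, 0 < p y)
    (h1 : ∫ y, gibbs d x p l u v y = 1)
    (hle : ∫ y, gibbs d x p l u v y * phi d x l y ≤ δ)
    (hcs : v * ∫ y, gibbs d x p l u v y * phi d x l y = v * δ)
    {w : ℝ × ℝ} (hw : 0 ≤ w.2) (hne : w ≠ (u, v)) :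
    dualObjective d x p δ l w < dualObjective d x p δ l (u, v) := by
  have hφ := continuous_phi x l hdi
  have hgd : IsDensity (gibbs d x p l u v) := isDensity_gibbs hdi hpc hp0 h1
  have hgc : Continuous (gibbs d x p l u v) := continuous_gibbs hdi hpc
  have hgp : ∀ y, 0 < gibbs d x p l u v y := fun y => mul_pos (hp0 y) (Real.exp_pos _)
  obtain ⟨y₀, hy₀⟩ : ∃ y, w.2 * phi d x l y + w.1 ≠ v * phi d x l y + u := by
    by_contra! hcon
    obtain ⟨j, hj⟩ := exists_sub_lt_dist hd hinj l
    obtain ⟨h2, h1⟩ := affine_phi_eq hd hdi hj hj hcon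
    exact hne (Prod.ext (by simp only; linarith) h2.symm)
  have huv : dualObjective d x p δ l (u, v) = -u - v * δ - 1 := by
    rw [dualObjective, show -u - v * δ - 1 = -u - v * δ - ∫ y, gibbs d x p l u v y by rw [h1]]
    congr 1
    refine integral_congr_ae (.of_forall fun y => ?_)
    simp only [gibbs]
    ring_nf
  set s : X → ℝ := fun y => (w.2 - v) * phi d x l y + (w.1 - u) with hs
  have hsc : Continuous s := by fun_prop
  have hwe : dualObjective d x p δ l w
      = -w.1 - w.2 * δ - ∫ y, gibbs d x p l u v y * Real.exp (-s y) := by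
    rw [dualObjective]
    congr 1
    refine integral_congr_ae (.of_forall fun y => ?_)
    simp only [gibbs, hs, mul_assoc, ← Real.exp_add]
    ring_nf
  have hpos : 0 < ∫ y, gibbs d x p l u v y * (Real.exp (-s y) - (1 - s y)) := by
    refine integral_pos_of_continuous (a := y₀) (by fun_prop) (fun y => ?_) ?_
    · have := Real.add_one_le_exp (-s y)
      exact mul_nonneg (hgp y).le (by linarith)
    · have := Real.add_one_lt_exp (x := -s y₀) (fun h => hy₀ (by simp only [hs] at h; linarith))
      exact mul_ne_zero (hgp y₀).ne' (by linarith)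
  have i1 : Integrable fun y => gibbs d x p l u v y * Real.exp (-s y) :=
    integrable_of_continuous (by fun_prop) _
  have i2 : Integrable fun y => (w.2 - v) * (gibbs d x p l u v y * phi d x l y) :=
    integrable_of_continuous (by fun_prop) _
  have i3 : Integrable fun y => (1 - (w.1 - u)) * gibbs d x p l u v y :=
    integrable_of_continuous (by fun_prop) _
  have e : (fun y => gibbs d x p l u v y * (Real.exp (-s y) - (1 - s y))) = fun y =>
      gibbs d x p l u v y * Real.exp (-s y) + (w.2 - v) * (gibbs d x p l u v y * phi d x l y)
        - (1 - (w.1 - u)) * gibbs d x p l u v y := by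
    funext y
    simp only [hs]
    ring
  rw [e, integral_sub (f := fun y => gibbs d x p l u v y * Real.exp (-s y)
      + (w.2 - v) * (gibbs d x p l u v y * phi d x l y)) (i1.add i2) i3, integral_add i1 i2,
    integral_const_mul, integral_const_mul, h1] at hpos
  rw [huv, hwe]
  have := mul_le_mul_of_nonneg_left hle hw
  linarith

/-- Sufficiency of the optimality conditions: feasibility (`h1`, `hW`), complementary slackness
(`hcs`), and, for the uniqueness of the weights, centres in the interior of their cells (`hsep`)
and `v ≠ 0` when `p` is not feasible. -/
theorem exists_unique_gibbs_of_optimality [T1Space X] (hd : IsMetric d)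
    (hdi : ∀ i, Continuous fun y => d y (x i)) (hinj : Function.Injective x)
    (hx : ∀ i j, i ≠ j → ∀ t : ℝ, volume {y : X | d y (x i) - d y (x j) = t} = 0)
    (hpc : Continuous p) (hp0 : ∀ y, 0 < p y) (hδ : 0 < δ)
    (hl : ∑ i, l i = 0) (hsep : ∀ i j, i ≠ j → l i - l j < d (x j) (x i))
    (hv : 0 ≤ v) (h1 : ∫ y, gibbs d x p l u v y = 1)
    (hW : wasserstein d (densityMeasure (gibbs d x p l u v)) (empiricalMeasure x)
      ≤ ENNReal.ofReal δ)
    (hcs : v * ∫ y, gibbs d x p l u v y * phi d x l y = v * δ)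
    (hpv : densityMeasure p ∉ wassersteinBall d (empiricalMeasure x) δ → v ≠ 0) :
    ∃ q : X → ℝ,
      IsMinEntropyDensity d (empiricalMeasure x) δ p q ∧
      (∀ q' : X → ℝ, IsMinEntropyDensity d (empiricalMeasure x) δ p q' → q' =ᵐ[volume] q) ∧
      ∃ (l : Fin N → ℝ) (u v : ℝ), ∑ i, l i = 0 ∧
        q =ᵐ[volume] gibbs d x p l u v ∧
        (∀ (l' : Fin N → ℝ) (u' v' : ℝ), ∑ i, l' i = 0 →
          q =ᵐ[volume] gibbs d x p l' u' v' →
            u' = u ∧ v' = v ∧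
            (densityMeasure p ∉ wassersteinBall d (empiricalMeasure x) δ → l' = l)) ∧
        0 ≤ v ∧
        ∀ l' : Fin N → ℝ, ∑ i, l' i = 0 →
          q =ᵐ[volume] gibbs d x p l' u v →
            StrictConcaveOn ℝ Set.univ (dualObjective d x p δ l') ∧
            ∀ w : ℝ × ℝ, 0 ≤ w.2 → w ≠ (u, v) →
              dualObjective d x p δ l' w < dualObjective d x p δ l' (u, v) := by
  have hgd : IsDensity (gibbs d x p l u v) := isDensity_gibbs hdi hpc hp0 h1
  have hfeas : Feasible d (empiricalMeasure x) δ (gibbs d x p l u v) :=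
    ⟨hgd, hgd.isProbabilityMeasure, hW⟩
  have hmean : ∀ q : X → ℝ, Feasible d (empiricalMeasure x) δ q → ∀ l' : Fin N → ℝ,
      ∑ i, l' i = 0 → ∫ y, q y * phi d x l' y ≤ δ := by
    intro q hq l' hl'
    have := hq.2.1
    rw [← hq.1.integral_densityMeasure]
    exact integral_phi_le_of_wasserstein_le hinj hl'
      (integrable_of_continuous (continuous_phi x l' hdi) _) hδ.le hq.2.2
  have hmin : ∀ q : X → ℝ, Feasible d (empiricalMeasure x) δ q →
      relEntropy (gibbs d x p l u v) p ≤ relEntropy q p ∧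
      (relEntropy q p ≤ relEntropy (gibbs d x p l u v) p → q =ᵐ[volume] gibbs d x p l u v) :=
    fun q hq => relEntropy_gibbs_le hdi hpc hp0 h1 hq.1 (by
      rw [hcs]
      exact mul_le_mul_of_nonneg_left (hmean q hq l hl) hv)
  have hparam : ∀ (l' : Fin N → ℝ) (u' v' : ℝ),
      gibbs d x p l u v =ᵐ[volume] gibbs d x p l' u' v' →
      ∀ y, v * phi d x l y + u = v' * phi d x l' y + u' := by
    intro l' u' v' h y
    have h := congrFun ((continuous_gibbs hdi hpc).ae_eq_iff_eq volume
      (continuous_gibbs hdi hpc) |>.1 h) y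
    have := log_gibbs_div (d := d) (x := x) (l := l) (u := u) (v := v) hp0 y
    rw [h, log_gibbs_div hp0] at this
    linarith
  refine ⟨gibbs d x p l u v, ⟨hfeas, fun q hq => (hmin q hq).1⟩,
    fun q hq => (hmin q hq.1).2 (hq.2 _ hfeas), l, u, v, hl, .rfl, ?_, hv, ?_⟩
  · intro l' u' v' hl' h
    obtain ⟨hu, hv', hll⟩ := parameters_unique hd hdi hinj hx hl hl' hsep (hparam l' u' v' h)
    exact ⟨hu, hv', fun hp => hll (hpv hp)⟩
  · intro l' hl' h
    have hφ := hparam l' u v h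
    have hgg : gibbs d x p l' u v = gibbs d x p l u v := by
      funext y
      have := hφ y
      simp only [gibbs]
      congr 2
      linarith
    refine ⟨strictConcaveOn_dualObjective hd hdi hinj hpc hp0 l', fun w hw hne => ?_⟩
    refine dualObjective_lt hd hdi hinj hpc hp0 (by rw [hgg, h1]) ?_ ?_ hw hne
    · rw [hgg]
      exact hmean _ hfeas l' hl'
    · rw [hgg, ← hcs, ← integral_const_mul, ← integral_const_mul]
      refine integral_congr_ae (.of_forall fun y => ?_)
      have := hφ y
      have h2 : v * phi d x l' y = v * phi d x l y := by linarith
      simp only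
      linear_combination gibbs d x p l u v y * h2

end Analysis

/-! ### Existence of optimal parameters -/

section Existence

open Filter Topology

lemma abs_le_of_sum_ge {N : ℕ} {l : Fin N → ℝ} {B s : ℝ} (hB : ∀ i, l i ≤ B) (hs : s ≤ ∑ i, l i)
    (i : Fin N) : |l i| ≤ |s| + (N + 1) * |B| := by
  have h1 : B - l i ≤ ∑ j, (B - l j) :=
    Finset.single_le_sum (f := fun j => B - l j) (fun j _ => sub_nonneg.2 (hB j))
      (Finset.mem_univ i)
  rw [Finset.sum_sub_distrib] at h1
  simp only [Finset.sum_const, Finset.card_univ, Fintype.card_fin, nsmul_eq_mul] at h1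
  have h2 := le_abs_self B
  have h3 := neg_abs_le B
  have h4 := neg_abs_le s
  have h5 := mul_le_mul_of_nonneg_left h2 (Nat.cast_nonneg (α := ℝ) N)
  have h6 := mul_nonneg (Nat.cast_nonneg (α := ℝ) N) (abs_nonneg B)
  rw [abs_le]
  constructor
  · linarith
  · linarith [hB i, abs_nonneg s]

lemma eq_zero_of_forall_quadratic_nonneg {a b r : ℝ} (hr : 0 < r)
    (h : ∀ s, |s| ≤ r → 0 ≤ s * a + s ^ 2 * b) : a = 0 := by
  have hmin : IsLocalMin (fun s : ℝ => s * a + s ^ 2 * b) 0 := by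
    filter_upwards [Metric.closedBall_mem_nhds (0 : ℝ) hr] with s hs
    simpa using h s (by simpa using hs)
  have hder : HasDerivAt (fun s : ℝ => s * a + s ^ 2 * b) a 0 := by
    have := ((hasDerivAt_id (0 : ℝ)).mul_const a).fun_add (((hasDerivAt_id (0 : ℝ)).pow 2).mul_const b)
    simpa using this
  exact hmin.hasDerivAt_eq_zero hder

variable {X : Type*} {N : ℕ} {d : X → X → ℝ} {x : Fin N → X} {p : X → ℝ}

section Cost

variable [MeasureSpace X]

/-- The convex dual functional in the variables `h = v • l + c` and `v`, where `c = -1 - u` has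
been absorbed into the weights. -/
noncomputable def dualCost (d : X → X → ℝ) (x : Fin N → X) (p : X → ℝ) (δ : ℝ) (h : Fin N → ℝ)
    (v : ℝ) : ℝ :=
  (∫ y, p y * Real.exp (-phi (fun a b => v * d a b) x h y)) + v * δ - (∑ i, h i) / N

variable [Nonempty (Fin N)]

lemma dualCost_eq {l : Fin N → ℝ} (hl : ∑ i, l i = 0) (δ c : ℝ) {v : ℝ} (hv : 0 ≤ v) :
    dualCost d x p δ (fun i => v * l i + c) v
      = (∫ y, gibbs d x p l (-1 - c) v y) + v * δ - c := by
  have hN : (N : ℝ) ≠ 0 := by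
    have := Fin.pos_iff_nonempty.2 ‹Nonempty (Fin N)›
    positivity
  have hs : (∑ i, (v * l i + c)) / N = c := by
    rw [Finset.sum_add_distrib, ← Finset.mul_sum, hl]
    simp [hN]
  rw [dualCost, hs]
  congr 2
  refine integral_congr_ae (.of_forall fun y => ?_)
  simp only [scaled_phi_eq d x l c hv, gibbs]
  ring_nf

end Cost

variable [TopologicalSpace X] [Nonempty (Fin N)]

/-- Passage to the limit from the cells with slack to the cells themselves. -/
lemma le_measureReal_cell [MeasurableSpace X] [BorelSpace X]
    (hdi : ∀ i, Continuous fun y => d y (x i)) (l : Fin N → ℝ) (j : Fin N) (ν : Measure X)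
    [IsFiniteMeasure ν] {a : ℝ} (h : ∀ t > 0, Real.exp (-t) * a ≤ ν.real (cell d x l j t)) :
    a ≤ ν.real (cell d x l j 0) := by
  have hint : ⋂ t > (0 : ℝ), cell d x l j t = cell d x l j 0 := by
    ext y
    simp only [cell, Set.mem_iInter, Set.mem_ofPred_eq]
    constructor
    · intro hy
      exact le_of_forall_pos_le_add fun t ht => by linarith [hy t ht]
    · intro hy t ht
      linarith
  have ht := tendsto_measure_biInter_gt (μ := ν) (s := cell d x l j) (a := 0)
    (fun t _ => (isClosed_cell x l hdi j t).measurableSet.nullMeasurableSet)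
    (fun s t _ hst y hy => by
      simp only [cell, Set.mem_ofPred_eq] at hy ⊢
      linarith) ⟨1, one_pos, measure_ne_top _ _⟩
  rw [hint] at ht
  have ht' : Tendsto (fun t => ν.real (cell d x l j t)) (𝓝[>] 0) (𝓝 (ν.real (cell d x l j 0))) :=
    (ENNReal.tendsto_toReal (measure_ne_top _ _)).comp ht
  have hl : Tendsto (fun t : ℝ => Real.exp (-t) * a) (𝓝[>] 0) (𝓝 a) := by
    have : Continuous fun t : ℝ => Real.exp (-t) * a := by fun_prop
    have h0 := this.tendsto 0
    simp only [neg_zero, Real.exp_zero, one_mul] at h0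
    exact h0.mono_left nhdsWithin_le_nhds
  refine le_of_tendsto_of_tendsto hl ht' ?_
  filter_upwards [self_mem_nhdsWithin] with t ht0 using h t ht0

variable [CompactSpace X] [MeasureSpace X] [BorelSpace X]

/-- For `v = 0` the cost is at least that of the trivial parameters, by `exp m - m ≥ 1`. -/
lemma one_le_dualCost_zero (hdi : ∀ i, Continuous fun y => d y (x i)) (hp0 : ∀ y, 0 < p y)
    (hp : IsDensity p) (δ : ℝ) (h : Fin N → ℝ) : 1 ≤ dualCost d x p δ h 0 := by
  have hN : (0 : ℝ) < N := by
    have := Fin.pos_iff_nonempty.2 ‹Nonempty (Fin N)›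
    exact_mod_cast this
  set m := (∑ i, h i) / N with hm
  have hφ := continuous_scaled_phi x h hdi 0
  have hle : ∀ y, phi (fun a b => 0 * d a b) x h y ≤ -m := fun y => by
    have : ∑ i, h i ≤ ∑ i : Fin N, -phi (fun a b => 0 * d a b) x h y :=
      Finset.sum_le_sum fun i _ => by
        have := phi_le (fun a b => 0 * d a b) x h i y
        linarith
    simp only [Finset.sum_const, Finset.card_univ, Fintype.card_fin, nsmul_eq_mul] at this
    have : m ≤ -phi (fun a b => 0 * d a b) x h y := by
      rw [hm, div_le_iff₀ hN]
      linarith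
    linarith
  have : Real.exp m ≤ ∫ y, p y * Real.exp (-phi (fun a b => 0 * d a b) x h y) := by
    calc Real.exp m = ∫ y, p y * Real.exp m := by
          rw [integral_mul_const, hp.integral_eq_one, one_mul]
      _ ≤ _ := by
          refine integral_mono (hp.integrable.mul_const _) (hp.integrable_mul (by fun_prop))
            fun y => ?_
          refine mul_le_mul_of_nonneg_left (Real.exp_le_exp.2 ?_) (hp0 y).le
          linarith [hle y]
  rw [dualCost, ← hm]
  linarith [Real.add_one_le_exp m]

/-- Along the ray `(s • l, s)` the cost has slope `δ - ∫ p * phi < 0` at `s = 0`, where it is one. -/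
lemma exists_dualCost_lt_one (hdi : ∀ i, Continuous fun y => d y (x i)) (hp : IsDensity p)
    {l : Fin N → ℝ} (hl : ∑ i, l i = 0) {δ : ℝ} (h : δ < ∫ y, p y * phi d x l y) :
    ∃ h' v', 0 ≤ v' ∧ dualCost d x p δ h' v' < 1 := by
  have hφ := continuous_phi x l hdi
  obtain ⟨M, hM, hb⟩ := exists_bound_of_continuous hφ
  set I := ∫ y, p y * phi d x l y with hI
  set s := min (1 / M) ((I - δ) / (2 * M ^ 2)) with hs
  have hIδ : 0 < I - δ := sub_pos.2 h
  have hs0 : 0 < s := by positivity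
  refine ⟨fun i => s * l i + 0, s, hs0.le, ?_⟩
  rw [dualCost_eq hl δ 0 hs0.le]
  have h1 : |s| * M ≤ 1 := by
    rw [abs_of_pos hs0, ← le_div_iff₀ hM]
    exact min_le_left _ _
  have h2 : s * (2 * M ^ 2) ≤ I - δ := by
    rw [← le_div_iff₀ (by positivity)]
    exact min_le_right _ _
  have h3 := integral_mul_exp_le hp hφ hb h1
  have h4 : ∫ y, gibbs d x p l (-1 - 0) s y = ∫ y, p y * Real.exp (-s * phi d x l y) := by
    refine integral_congr_ae (.of_forall fun y => ?_)
    simp only [gibbs]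
    ring_nf
  rw [h4]
  have := mul_le_mul_of_nonneg_left h2 hs0.le
  have h5 : 0 < s * (I - δ) := mul_pos hs0 hIδ
  linarith

variable [IsFiniteMeasure (volume : Measure X)]

/-- Existence of an optimal dual potential for the transport of `p` to the empirical measure. -/
lemma exists_wasserstein_le_integral_phi (hdi : ∀ i, Continuous fun y => d y (x i))
    (hd0 : ∀ a b, 0 ≤ d a b)
    (hx : ∀ i j, i ≠ j → ∀ t : ℝ, volume {y : X | d y (x i) - d y (x j) = t} = 0)
    (hpc : Continuous p) (hp0 : ∀ y, 0 < p y) (hp : IsDensity p) :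
    ∃ l : Fin N → ℝ, ∑ i, l i = 0 ∧ wasserstein d (densityMeasure p) (empiricalMeasure x)
      ≤ ENNReal.ofReal (∫ y, p y * phi d x l y) := by
  have hN : (0 : ℝ) < N := by
    have := Fin.pos_iff_nonempty.2 ‹Nonempty (Fin N)›
    exact_mod_cast this
  have hφ := fun l => continuous_phi x l hdi
  set f : (Fin N → ℝ) → ℝ := fun l => ∫ y, p y * phi d x l y with hf
  have hfc : Continuous f := by
    have : Continuous fun z : (Fin N → ℝ) × X => p z.2 * phi d x z.1 z.2 := by
      refine (hpc.comp continuous_snd).mul ?_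
      exact continuous_ciInf_of_finite fun i =>
        ((hdi i).comp continuous_snd).sub ((continuous_apply i).comp continuous_fst)
    have h := continuous_parametric_integral_of_continuous (μ := (volume : Measure X))
      (f := fun (l : Fin N → ℝ) y => p y * phi d x l y) this isCompact_univ
    simpa using h
  -- an upper bound of all distances to the centres
  obtain ⟨D, hD⟩ : ∃ D, ∀ i y, d y (x i) ≤ D := by
    choose C hC using fun i => isCompact_univ.exists_bound_of_continuousOn (hdi i).continuousOn
    obtain ⟨k, hk⟩ := Finite.exists_max C
    exact ⟨C k, fun i y => ((le_abs_self _).trans (hC i y (Set.mem_univ y))).trans (hk i)⟩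
  have hfle : ∀ l i, f l ≤ D - l i := by
    intro l i
    have h1 : f l ≤ ∫ y, p y * (D - l i) := by
      refine integral_mono (hp.integrable_mul (hφ l)) (hp.integrable.mul_const _) fun y => ?_
      have := phi_le d x l i y
      exact mul_le_mul_of_nonneg_left (by linarith [hD i y]) (hp0 y).le
    rwa [integral_mul_const, hp.integral_eq_one, one_mul] at h1
  set T : Set (Fin N → ℝ) := {l | ∑ i, l i = 0 ∧ f 0 ≤ f l} with hT
  have hTc : IsCompact T := by
    refine Metric.isCompact_of_isClosed_isBounded ?_ ?_
    · exact (isClosed_eq (by fun_prop) continuous_const).inter (isClosed_le continuous_const hfc)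
    · refine Metric.isBounded_closedBall (x := 0) (r := |(0 : ℝ)| + (N + 1) * |D - f 0|) |>.subset ?_
      intro l hl
      rw [mem_closedBall_zero_iff, pi_norm_le_iff_of_nonneg (by positivity)]
      exact fun i => abs_le_of_sum_ge (fun i => by linarith [hfle l i, hl.2]) hl.1.ge i
  obtain ⟨l, hl, hmax⟩ := hTc.exists_isMaxOn ⟨0, by simp [hT]⟩ hfc.continuousOn
  have hopt : ∀ l' : Fin N → ℝ, f l' + (∑ i, l' i) / N ≤ f l := by
    intro l'
    set c := (∑ i, l' i) / N with hc
    have hsum : ∑ i, (l' i + -c) = 0 := by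
      rw [Finset.sum_add_distrib]
      simp only [Finset.sum_const, Finset.card_univ, Fintype.card_fin, nsmul_eq_mul, hc]
      field_simp
      ring
    have hfl : f (fun i => l' i + -c) = f l' + c := by
      simp only [hf, phi_add_const, sub_neg_eq_add, mul_add]
      rw [integral_add (hp.integrable_mul (hφ l')) (hp.integrable.mul_const c),
        integral_mul_const, hp.integral_eq_one, one_mul]
    rw [← hfl]
    by_cases h0 : f 0 ≤ f (fun i => l' i + -c)
    · exact hmax ⟨hsum, h0⟩
    · exact (not_le.1 h0).le.trans hl.2
  refine ⟨l, hl.1, ?_⟩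
  have := hp.isProbabilityMeasure
  rw [← hp.integral_densityMeasure]
  refine wasserstein_le_of_cells (fun i => (isClosed_cell x l hdi i 0).measurableSet)
    (fun i j hij t => densityMeasure_absolutelyContinuous p (hx i j hij t)) hl.1
    (integrable_of_continuous (hφ l) _) hd0 fun j => ?_
  refine le_measureReal_cell hdi l j _ fun t ht => ?_
  have hm : MeasurableSet (cell d x l j t) := (isClosed_cell x l hdi j t).measurableSet
  have hone := hopt (l + Pi.single j t)
  have hs : ∑ i, (l + Pi.single j t : Fin N → ℝ) i = t := by
    simp [Finset.sum_add_distrib, hl.1]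
  rw [hs] at hone
  have i1 : Integrable fun y => p y * (cell d x l j t).indicator 1 y := by
    refine (hp.integrable.indicator hm).congr (.of_forall fun y => ?_)
    by_cases hy : y ∈ cell d x l j t <;> simp [hy]
  have hlow : f l - t * (densityMeasure p).real (cell d x l j t) ≤ f (l + Pi.single j t) := by
    rw [hp.measureReal_eq hm, ← integral_const_mul, hf]
    dsimp only
    rw [← integral_sub (hp.integrable_mul (hφ l)) (i1.const_mul t)]
    refine integral_mono ((hp.integrable_mul (hφ l)).sub (i1.const_mul t))
      (hp.integrable_mul (hφ _)) fun y => ?_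
    by_cases hy : y ∈ cell d x l j t
    · have := mul_le_mul_of_nonneg_left (phi_sub_le_phi_add_single d x l j ht.le y) (hp0 y).le
      simp only [hy, Set.indicator_of_mem, Pi.one_apply]
      linarith
    · have := mul_le_mul_of_nonneg_left (phi_le_phi_add_single d x l hy) (hp0 y).le
      simp only [hy, Set.indicator_of_notMem, not_false_eq_true]
      linarith
  have hge : (N : ℝ)⁻¹ ≤ (densityMeasure p).real (cell d x l j t) := by
    refine le_of_mul_le_mul_left ?_ ht
    rw [← div_eq_mul_inv]
    linarith
  refine le_trans ?_ hge
  exact mul_le_of_le_one_left (by positivity) (Real.exp_le_one_iff.2 (by linarith))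

lemma continuous_dualCost (hdi : ∀ i, Continuous fun y => d y (x i)) (hpc : Continuous p) (δ : ℝ) :
    Continuous fun z : (Fin N → ℝ) × ℝ => dualCost d x p δ z.1 z.2 := by
  have : Continuous fun z : ((Fin N → ℝ) × ℝ) × X =>
      p z.2 * Real.exp (-phi (fun a b => z.1.2 * d a b) x z.1.1 z.2) := by
    refine (hpc.comp continuous_snd).mul (Real.continuous_exp.comp (Continuous.neg ?_))
    exact continuous_ciInf_of_finite fun i =>
      ((continuous_snd.comp continuous_fst).mul ((hdi i).comp continuous_snd)).sub
        ((continuous_apply i).comp (continuous_fst.comp continuous_fst))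
  have h := continuous_parametric_integral_of_continuous (μ := (volume : Measure X))
    (f := fun (z : (Fin N → ℝ) × ℝ) y => p y * Real.exp (-phi (fun a b => z.2 * d a b) x z.1 y))
    this isCompact_univ
  simp only [Measure.restrict_univ] at h
  unfold dualCost
  fun_prop

/-- The mass of `p` near the centres bounds the exponential term from below. -/
lemma exists_mul_exp_le_integral [(volume : Measure X).IsOpenPosMeasure] (hd : IsMetric d)
    (hdi : ∀ i, Continuous fun y => d y (x i)) (hpc : Continuous p) (hp0 : ∀ y, 0 < p y) {δ : ℝ}
    (hδ : 0 < δ) : ∃ m > 0, ∀ (h : Fin N → ℝ) (v : ℝ), 0 ≤ v → ∀ i,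
      m * Real.exp (h i - v * (δ / 2)) ≤
        ∫ y, p y * Real.exp (-phi (fun a b => v * d a b) x h y) := by
  -- a tent around each centre, supported in the ball of radius `δ / 2`
  set b : Fin N → X → ℝ := fun i y => p y * max 0 (1 - d y (x i) / (δ / 2)) with hb
  have hbc : ∀ i, Continuous (b i) := fun i => by
    have := hdi i
    fun_prop
  obtain ⟨k, hk⟩ := Finite.exists_min fun i => ∫ y, b i y
  refine ⟨∫ y, b k y, ?_, fun h v hv i => ?_⟩
  · refine integral_pos_of_continuous (hbc k)
      (fun y => mul_nonneg (hp0 y).le (le_max_left _ _)) (a := x k) ?_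
    simp [hb, (hd.eq_zero_iff (x k) (x k)).2 rfl, (hp0 (x k)).ne']
  · have hφ := continuous_scaled_phi x h hdi v
    refine (mul_le_mul_of_nonneg_right (hk i) (Real.exp_pos _).le).trans ?_
    rw [← integral_mul_const]
    refine integral_mono (integrable_of_continuous ((hbc i).mul continuous_const) _)
      (integrable_of_continuous (by fun_prop) _) fun y => ?_
    simp only [hb, mul_assoc]
    refine mul_le_mul_of_nonneg_left ?_ (hp0 y).le
    have hd0 := hd.nonneg y (x i)
    rcases le_total (δ / 2) (d y (x i)) with hle | hle
    · rw [max_eq_left (by rw [sub_nonpos, le_div_iff₀ (by positivity)]; linarith), zero_mul]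
      exact (Real.exp_pos _).le
    · refine (mul_le_of_le_one_left (Real.exp_pos _).le (max_le zero_le_one ?_)).trans ?_
      · have : 0 ≤ d y (x i) / (δ / 2) := by positivity
        linarith
      · refine Real.exp_le_exp.2 ?_
        have := phi_le (fun a b => v * d a b) x h i y
        have := mul_le_mul_of_nonneg_left hle hv
        linarith

/-- The dual cost is coercive on `0 ≤ v`, so it attains its minimum there. -/
lemma exists_dualCost_min [(volume : Measure X).IsOpenPosMeasure] (hd : IsMetric d)
    (hdi : ∀ i, Continuous fun y => d y (x i)) (hpc : Continuous p) (hp0 : ∀ y, 0 < p y)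
    (hp : IsDensity p) {δ : ℝ} (hδ : 0 < δ) :
    ∃ (h : Fin N → ℝ) (v : ℝ), 0 ≤ v ∧
      ∀ h' v', 0 ≤ v' → dualCost d x p δ h v ≤ dualCost d x p δ h' v' := by
  have hN : (0 : ℝ) < N := by
    have := Fin.pos_iff_nonempty.2 ‹Nonempty (Fin N)›
    exact_mod_cast this
  obtain ⟨m, hm, hlow⟩ := exists_mul_exp_le_integral hd hdi hpc hp0 hδ
  have hGc := continuous_dualCost hdi hpc δ
  set T : Set ((Fin N → ℝ) × ℝ) := {z | 0 ≤ z.2 ∧ dualCost d x p δ z.1 z.2 ≤ 1} with hT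
  set a := Real.log m with ha
  have hbound : ∀ h v, 0 ≤ v → dualCost d x p δ h v ≤ 1 →
      (∀ i, h i ≤ 1 - 2 * a) ∧ -(N : ℝ) ≤ ∑ i, h i ∧ v ≤ -2 * a / δ := by
    intro h v hv hG
    obtain ⟨k, hk⟩ := Finite.exists_max h
    have hmean : (∑ i, h i) / N ≤ h k := by
      rw [div_le_iff₀ hN]
      refine (Finset.sum_le_sum fun i _ => hk i).trans ?_
      simp [mul_comm]
    set z := a + (h k - v * (δ / 2)) with hz
    have hexp : Real.exp z + v * δ - (∑ i, h i) / N ≤ 1 := by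
      have := hlow h v hv k
      rw [hz, Real.exp_add, ha, Real.exp_log hm]
      rw [dualCost] at hG
      linarith
    -- two tangent lines of the exponential, with slopes one and two
    have h1 := Real.add_one_le_exp z
    have h2 : 2 * z ≤ Real.exp z := by
      have e : Real.exp z = 2 * Real.exp (z - Real.log 2) := by
        rw [Real.exp_sub, Real.exp_log two_pos]
        ring
      have := Real.add_one_le_exp (z - Real.log 2)
      have := Real.log_two_lt_d9
      linarith
    have hvδ : 0 ≤ v * δ := mul_nonneg hv hδ.le
    refine ⟨fun i => (hk i).trans (by linarith), ?_, ?_⟩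
    · have := Real.exp_pos z
      have h3 : -1 ≤ (∑ i, h i) / N := by linarith
      rw [le_div_iff₀ hN] at h3
      linarith
    · rw [le_div_iff₀ hδ]
      linarith
  have hTc : IsCompact T := by
    refine Metric.isCompact_of_isClosed_isBounded ?_ ?_
    · exact (isClosed_le continuous_const continuous_snd).inter (isClosed_le hGc continuous_const)
    · refine (Metric.isBounded_closedBall (x := 0)
        (r := max (|-(N : ℝ)| + (N + 1) * |1 - 2 * a|) |-2 * a / δ|)).subset ?_
      rintro ⟨h, v⟩ ⟨hv, hG⟩
      obtain ⟨b1, b2, b3⟩ := hbound h v hv hG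
      rw [mem_closedBall_zero_iff, Prod.norm_mk]
      refine max_le_max ?_ ?_
      · rw [pi_norm_le_iff_of_nonneg (by positivity)]
        exact fun i => abs_le_of_sum_ge b1 b2 i
      · rw [Real.norm_of_nonneg hv]
        exact b3.trans (le_abs_self _)
  have h0 : dualCost d x p δ 0 0 = 1 := by
    simp [dualCost, phi, hp.integral_eq_one]
  obtain ⟨z, hz, hmin⟩ := hTc.exists_isMinOn ⟨(0, 0), le_rfl, h0.le⟩ hGc.continuousOn
  refine ⟨z.1, z.2, hz.1, fun h' v' hv' => ?_⟩
  by_cases h1 : dualCost d x p δ h' v' ≤ 1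
  · exact isMinOn_iff.1 hmin (h', v') ⟨hv', h1⟩
  · exact hz.2.trans (not_le.1 h1).le

/-- The first-order conditions at a minimiser with `v > 0`: unit mass, mean of `phi` equal to `δ`,
cells of mass at least `1 / N`. -/
lemma optimality_of_min (hdi : ∀ i, Continuous fun y => d y (x i)) (hpc : Continuous p)
    (hp0 : ∀ y, 0 < p y) (hp : IsDensity p) {δ : ℝ} {l : Fin N → ℝ} (hl : ∑ i, l i = 0) {c v : ℝ}
    (hv : 0 < v) (hmin : ∀ h' v', 0 ≤ v' →
      dualCost d x p δ (fun i => v * l i + c) v ≤ dualCost d x p δ h' v') :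
    (∫ y, gibbs d x p l (-1 - c) v y = 1) ∧
    (∫ y, gibbs d x p l (-1 - c) v y * phi d x l y = δ) ∧
    ∀ j, (N : ℝ)⁻¹ ≤ (densityMeasure (gibbs d x p l (-1 - c) v)).real (cell d x l j 0) := by
  set g := gibbs d x p l (-1 - c) v with hg
  have hφ := continuous_phi x l hdi
  have hgc : Continuous g := continuous_gibbs hdi hpc
  have hgp : ∀ y, 0 < g y := fun y => mul_pos (hp0 y) (Real.exp_pos _)
  rw [dualCost_eq hl δ c hv.le] at hmin
  set F := ∫ y, g y with hF
  have hFpos : 0 < F := by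
    rw [hF, integral_pos_iff_support_of_nonneg (fun y => (hgp y).le)
      (integrable_of_continuous hgc _)]
    rw [Function.support_eq_univ fun y => (hgp y).ne']
    refine pos_iff_ne_zero.2 fun h0 => ?_
    have h1 := hp.integral_eq_one
    rw [Measure.measure_univ_eq_zero.1 h0] at h1
    simp at h1
  -- shifting all weights by `-log F` normalises the mass
  have hF1 : F = 1 := by
    by_contra hne
    have h1 := hmin (fun i => v * l i + (c - Real.log F)) v hv.le
    rw [dualCost_eq hl δ _ hv.le] at h1
    have h2 : ∫ y, gibbs d x p l (-1 - (c - Real.log F)) v y = 1 := by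
      have : ∀ y, gibbs d x p l (-1 - (c - Real.log F)) v y = g y * F⁻¹ := fun y => by
        rw [← Real.exp_log hFpos, ← Real.exp_neg, hg]
        simp only [gibbs, mul_assoc, ← Real.exp_add, Real.log_exp]
        ring_nf
      simp_rw [this]
      rw [integral_mul_const, ← hF, mul_inv_cancel₀ hFpos.ne']
    rw [h2] at h1
    linarith [Real.log_lt_sub_one_of_pos hFpos hne]
  have hgd : IsDensity g := isDensity_gibbs hdi hpc hp0 hF1
  refine ⟨hF1, ?_, fun j => ?_⟩
  · obtain ⟨M, hM, hb⟩ := exists_bound_of_continuous hφ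
    -- replacing `v` by `v + s` with `l` and `c` fixed, to second order in `s`
    have := eq_zero_of_forall_quadratic_nonneg (a := δ - ∫ y, g y * phi d x l y) (b := M ^ 2)
      (r := min v (1 / M)) (by positivity) fun s hs => by
        have hsv : 0 ≤ v + s := by linarith [(abs_le.1 (hs.trans (min_le_left _ _))).1]
        have hsM : |s| * M ≤ 1 := (le_div_iff₀ hM).1 (hs.trans (min_le_right _ _))
        have h1 := hmin (fun i => (v + s) * l i + c) (v + s) hsv
        rw [dualCost_eq hl δ _ hsv] at h1
        have h2 : ∫ y, gibbs d x p l (-1 - c) (v + s) y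
            = ∫ y, g y * Real.exp (-s * phi d x l y) := by
          refine integral_congr_ae (.of_forall fun y => ?_)
          simp only [hg, gibbs, mul_assoc, ← Real.exp_add]
          ring_nf
        have h3 := integral_mul_exp_le hgd hφ hb hsM
        rw [h2, hF1] at h1
        linarith
    linarith
  · have := hgd.isProbabilityMeasure
    set h : Fin N → ℝ := fun i => v * l i + c with hh
    have hcell : cell (fun a b => v * d a b) x h j 0 = cell d x l j 0 := by
      ext y
      simp only [cell, Set.mem_ofPred_eq, hh, scaled_phi_eq d x l c hv.le]
      rw [← mul_le_mul_iff_of_pos_left hv (b := d y (x j) - l j - 0)]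
      constructor <;> intro h <;> linarith
    have hvdi : ∀ i, Continuous fun y => (fun a b => v * d a b) y (x i) := fun i =>
      continuous_const.mul (hdi i)
    rw [← hcell]
    refine le_measureReal_cell hvdi h j _ fun t ht => ?_
    have hm : MeasurableSet (cell (fun a b => v * d a b) x h j t) :=
      (isClosed_cell x h hvdi j t).measurableSet
    set C := cell (fun a b => v * d a b) x h j t with hC
    -- raising the `j`-th weight by `t` affects only the `j`-th cell with slack `t`
    have hone := hmin (h + Pi.single j t) v hv.le
    have hN : (N : ℝ) ≠ 0 := by
      have := Fin.pos_iff_nonempty.2 ‹Nonempty (Fin N)›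
      positivity
    have hs : (∑ i, (h + Pi.single j t : Fin N → ℝ) i) / N = c + t / N := by
      simp only [Pi.add_apply, hh, Finset.sum_add_distrib, ← Finset.mul_sum, hl]
      simp
      field_simp
    rw [dualCost, hs, hF1] at hone
    have i1 : Integrable fun y => g y * C.indicator 1 y := by
      refine (hgd.integrable.indicator hm).congr (.of_forall fun y => ?_)
      by_cases hy : y ∈ C <;> simp [hy]
    have hge : ∀ y, g y = p y * Real.exp (-phi (fun a b => v * d a b) x h y) := fun y => by
      rw [hh, scaled_phi_eq d x l c hv.le, hg, gibbs]
      ring_nf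
    have hup : ∫ y, p y * Real.exp (-phi (fun a b => v * d a b) x (h + Pi.single j t) y)
        ≤ F + (Real.exp t - 1) * (densityMeasure g).real C := by
      rw [hgd.measureReal_eq hm, ← integral_const_mul, hF,
        ← integral_add hgd.integrable (i1.const_mul _)]
      refine integral_mono ?_ (hgd.integrable.add (i1.const_mul _)) fun y => ?_
      · have := continuous_scaled_phi x (h + Pi.single j t) hdi v
        exact hp.integrable_mul (by fun_prop)
      by_cases hy : y ∈ C
      · simp only [hy, Set.indicator_of_mem, Pi.one_apply, hge]
        have h1 := phi_sub_le_phi_add_single (fun a b => v * d a b) x h j ht.le y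
        have h2 : Real.exp (-phi (fun a b => v * d a b) x (h + Pi.single j t) y)
            ≤ Real.exp t * Real.exp (-phi (fun a b => v * d a b) x h y) := by
          rw [← Real.exp_add]
          exact Real.exp_le_exp.2 (by linarith)
        have := mul_le_mul_of_nonneg_left h2 (hp0 y).le
        linarith
      · simp only [hy, Set.indicator_of_notMem, not_false_eq_true, hge]
        have h1 := phi_le_phi_add_single (fun a b => v * d a b) x h hy
        have := mul_le_mul_of_nonneg_left (Real.exp_le_exp.2 (neg_le_neg h1)) (hp0 y).le
        linarith
    have h1 : t / N ≤ (Real.exp t - 1) * (densityMeasure g).real C := by linarith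
    -- `exp t - 1 ≤ t * exp t`
    have h2 : Real.exp t - 1 ≤ t * Real.exp t := by
      have h3 := mul_le_mul_of_nonneg_right (Real.add_one_le_exp (-t)) (Real.exp_pos t).le
      rw [← Real.exp_add, neg_add_cancel, Real.exp_zero] at h3
      linarith
    have h4 := h1.trans (mul_le_mul_of_nonneg_right h2 measureReal_nonneg)
    rw [div_eq_mul_inv, mul_assoc] at h4
    have h5 := le_of_mul_le_mul_left h4 ht
    rw [Real.exp_neg, inv_mul_le_iff₀ (Real.exp_pos t)]
    exact h5

end Existence

/-! ### The theorem on a compact space -/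

/-- The conclusion on a compact space with a finite measure that has full support and no atoms. -/
theorem exists_unique_gibbs {X : Type*} [TopologicalSpace X] [CompactSpace X] [T1Space X]
    [MeasureSpace X] [BorelSpace X] [IsFiniteMeasure (volume : Measure X)]
    [(volume : Measure X).IsOpenPosMeasure] [NullSingletonClass (volume : Measure X)]
    {N : ℕ} [Nonempty (Fin N)] {d : X → X → ℝ} {x : Fin N → X} {p : X → ℝ} {δ : ℝ}
    (hd : IsMetric d) (hdi : ∀ i, Continuous fun y => d y (x i))
    (hx : ∀ i j, i ≠ j → ∀ t : ℝ, volume {y : X | d y (x i) - d y (x j) = t} = 0)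
    (hpc : Continuous p) (hp0 : ∀ y, 0 < p y) (hp : IsDensity p) (hδ : 0 < δ) :
    ∃ q : X → ℝ,
      IsMinEntropyDensity d (empiricalMeasure x) δ p q ∧
      (∀ q' : X → ℝ, IsMinEntropyDensity d (empiricalMeasure x) δ p q' → q' =ᵐ[volume] q) ∧
      ∃ (l : Fin N → ℝ) (u v : ℝ), ∑ i, l i = 0 ∧
        q =ᵐ[volume] gibbs d x p l u v ∧
        (∀ (l' : Fin N → ℝ) (u' v' : ℝ), ∑ i, l' i = 0 →
          q =ᵐ[volume] gibbs d x p l' u' v' →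
            u' = u ∧ v' = v ∧
            (densityMeasure p ∉ wassersteinBall d (empiricalMeasure x) δ → l' = l)) ∧
        0 ≤ v ∧
        ∀ l' : Fin N → ℝ, ∑ i, l' i = 0 →
          q =ᵐ[volume] gibbs d x p l' u v →
            StrictConcaveOn ℝ Set.univ (dualObjective d x p δ l') ∧
            ∀ w : ℝ × ℝ, 0 ≤ w.2 → w ≠ (u, v) →
              dualObjective d x p δ l' w < dualObjective d x p δ l' (u, v) := by
  have hne : Nonempty X := ‹Nonempty (Fin N)›.map x
  have hinj := injective_of_measure_level_eq_zero hx
  by_cases hpB : densityMeasure p ∈ wassersteinBall d (empiricalMeasure x) δ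
  · have hg : gibbs d x p 0 (-1) 0 = p := by
      funext y
      simp [gibbs]
    exact exists_unique_gibbs_of_optimality (l := 0) (u := -1) (v := 0) hd hdi hinj hx hpc hp0 hδ
      (by simp) (fun i j hij => by simpa using hd.pos (hinj.ne hij.symm)) le_rfl
      (by rw [hg, hp.integral_eq_one]) (by rw [hg]; exact hpB.2) (by simp)
      (fun h => absurd hpB h)
  obtain ⟨l₀, hl₀, hW₀⟩ := exists_wasserstein_le_integral_phi hdi hd.nonneg hx hpc hp0 hp
  have hlt : δ < ∫ y, p y * phi d x l₀ y := by
    by_contra! hle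
    exact hpB ⟨hp.isProbabilityMeasure, hW₀.trans (ENNReal.ofReal_le_ofReal hle)⟩
  obtain ⟨h₁, v₁, hv₁, hlt₁⟩ := exists_dualCost_lt_one hdi hp hl₀ hlt
  obtain ⟨h, v, hv, hmin⟩ := exists_dualCost_min (x := x) hd hdi hpc hp0 hp hδ
  have hv0 : 0 < v := by
    refine hv.lt_of_ne ?_
    rintro rfl
    linarith [hmin h₁ v₁ hv₁, one_le_dualCost_zero hdi hp0 hp δ h]
  have hN : (N : ℝ) ≠ 0 := by
    have := Fin.pos_iff_nonempty.2 ‹Nonempty (Fin N)›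
    positivity
  -- centring and rescaling the optimal weights
  obtain ⟨l, c, hl, hh⟩ : ∃ (l : Fin N → ℝ) (c : ℝ), ∑ i, l i = 0 ∧ h = fun i => v * l i + c := by
    refine ⟨fun i => (h i - (∑ i, h i) / N) / v, (∑ i, h i) / N, ?_, ?_⟩
    · rw [← Finset.sum_div, Finset.sum_sub_distrib]
      simp only [Finset.sum_const, Finset.card_univ, Fintype.card_fin, nsmul_eq_mul]
      field_simp
      ring
    · funext i
      field_simp
      ring
  rw [hh] at hmin
  obtain ⟨hmass, hmean, hcell⟩ := optimality_of_min hdi hpc hp0 hp hl hv0 hmin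
  have hgd := isDensity_gibbs hdi hpc hp0 hmass
  have := hgd.isProbabilityMeasure
  refine exists_unique_gibbs_of_optimality hd hdi hinj hx hpc hp0 hδ hl ?_ hv hmass ?_ (by rw [hmean])
    fun _ => hv0.ne'
  · intro i j hij
    refine sub_lt_dist_of_measure_cell_pos hd hx (fun h0 => ?_) i hij
    have h1 := hcell j
    rw [Measure.real, densityMeasure_absolutelyContinuous _ h0, ENNReal.toReal_zero] at h1
    have : (0 : ℝ) < (N : ℝ)⁻¹ := by positivity
    linarith
  · have hW := wasserstein_le_of_cells (fun i => (isClosed_cell x l hdi i 0).measurableSet)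
      (fun i j hij t => densityMeasure_absolutelyContinuous _ (hx i j hij t)) hl
      (integrable_of_continuous (continuous_phi x l hdi) _) hd.nonneg hcell
    rwa [hgd.integral_densityMeasure, hmean] at hW

/-! ### Lebesgue measure on a regular compact set -/

section RegularCompact

variable {n : ℕ} {K : Set (EuclideanSpace ℝ (Fin n))}

lemma IsRegularCompact.isCompact (hK : IsRegularCompact K) : IsCompact K := by
  obtain ⟨U, -, hb, rfl⟩ := hK
  exact hb.isCompact_closure

lemma IsRegularCompact.volume_apply (hK : IsRegularCompact K) (s : Set K) :
    volume s = volume (Subtype.val '' s) :=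
  comap_subtype_coe_apply hK.isCompact.measurableSet _ s

lemma IsRegularCompact.isFiniteMeasure (hK : IsRegularCompact K) :
    IsFiniteMeasure (volume : Measure K) := by
  constructor
  rw [hK.volume_apply, Set.image_univ, Subtype.range_coe]
  exact hK.isCompact.measure_lt_top

lemma IsRegularCompact.nullSingletonClass (hK : IsRegularCompact K) (hn : 1 ≤ n) :
    NullSingletonClass (volume : Measure K) := by
  have : Nonempty (Fin n) := ⟨⟨0, hn⟩⟩
  constructor
  intro y
  rw [hK.volume_apply, Set.image_singleton]
  exact measure_singleton _

lemma IsRegularCompact.isOpenPosMeasure (hK : IsRegularCompact K) :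
    (volume : Measure K).IsOpenPosMeasure := by
  constructor
  rintro V hV ⟨y, hy⟩ h0
  rw [hK.volume_apply] at h0
  obtain ⟨U, hU, -, rfl⟩ := hK
  obtain ⟨O, hO, rfl⟩ := isOpen_induced_iff.1 hV
  -- a relatively open set meets the open set whose closure is `K`
  obtain ⟨z, hz⟩ := mem_closure_iff.1 y.2 O hO hy
  refine (hO.inter hU).measure_ne_zero volume ⟨z, hz⟩ (measure_mono_null ?_ h0)
  exact fun a ha => ⟨⟨a, subset_closure ha.2⟩, ha.1, rfl⟩

end RegularCompact

end MinEntropy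

theorem theorem1p2 {n N : ℕ} (hn : 1 ≤ n) (hN : 1 ≤ N)
    (K : Set (EuclideanSpace ℝ (Fin n))) (hK : MinEntropy.IsRegularCompact K)
    (d : K → K → ℝ) (hd : MinEntropy.IsMetric d)
    (hdc : Continuous fun z : K × K => d z.1 z.2)
    (x : Fin N → K)
    (hx : ∀ i j, i ≠ j → ∀ t : ℝ, volume {y : K | d y (x i) - d y (x j) = t} = 0)
    (p : K → ℝ) (hpc : Continuous p) (hp0 : ∀ y, 0 < p y) (hp : MinEntropy.IsDensity p)
    (δ : ℝ) (hδ : 0 < δ) :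
    ∃ q : K → ℝ,
      -- `q` is the unique density of minimum relative entropy in the ball
      MinEntropy.IsMinEntropyDensity d (MinEntropy.empiricalMeasure x) δ p q ∧
      (∀ q' : K → ℝ,
        MinEntropy.IsMinEntropyDensity d (MinEntropy.empiricalMeasure x) δ p q' →
          q' =ᵐ[volume] q) ∧
      ∃ (l : Fin N → ℝ) (u v : ℝ), ∑ i, l i = 0 ∧
        -- the formula for `q`
        q =ᵐ[volume] MinEntropy.gibbs d x p l u v ∧
        -- uniqueness of the parameters in the formula
        (∀ (l' : Fin N → ℝ) (u' v' : ℝ), ∑ i, l' i = 0 →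
          q =ᵐ[volume] MinEntropy.gibbs d x p l' u' v' →
            u' = u ∧ v' = v ∧
            (MinEntropy.densityMeasure p ∉
              MinEntropy.wassersteinBall d (MinEntropy.empiricalMeasure x) δ → l' = l)) ∧
        -- for each vector that can be used in the formula, `(u, v)` is the unique maximizer of
        -- the strictly concave problem
        0 ≤ v ∧
        ∀ l' : Fin N → ℝ, ∑ i, l' i = 0 →
          q =ᵐ[volume] MinEntropy.gibbs d x p l' u v →
            StrictConcaveOn ℝ Set.univ (MinEntropy.dualObjective d x p δ l') ∧
            ∀ w : ℝ × ℝ, 0 ≤ w.2 → w ≠ (u, v) →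
              MinEntropy.dualObjective d x p δ l' w < MinEntropy.dualObjective d x p δ l' (u, v) := by
  have : Nonempty (Fin N) := ⟨⟨0, hN⟩⟩
  have := isCompact_iff_compactSpace.1 hK.isCompact
  have := hK.isFiniteMeasure
  have := hK.isOpenPosMeasure
  have := hK.nullSingletonClass hn
  exact MinEntropy.exists_unique_gibbs hd
    (fun i => hdc.comp (continuous_id.prodMk continuous_const)) hx hpc hp0 hp hδ
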